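/- Let $d\in\mathbb N$, let $\mathbb P=N(\mu,\Sigma)$ and $\mathbb Q=N(\nu,\Xi)$ be Gaussian laws on $\mathbb R^d$ with $\Sigma,\Xi$ symmetric positive definite, and suppose $\mathbb P\neq\mathbb Q$. Let $\mathcal W_2(P,Q)=\inf_\pi\big(\int\|x-y\|^2\,\pi(dx,dy)\big)^{1/2}$ be the $2$-Wasserstein distance, where the infimum is over all couplings $\pi$ of $P$ and $Q$. For $x_1,\dots,x_n\in\mathbb R^d$ put $$\hat\mu_n=\frac1n\sum_{i=1}^n x_i,\qquad \hat\Sigma_n=\frac1{n-1}\sum_{i=1}^n (x_i-\hat\mu_n)(x_i-\hat\mu_n)^t,\qquad \widehat{\mathcal{GW}}_n(x_1,\dots,x_n)=\mathcal W_2^2\big(N(\hat\mu_n,\hat\Sigma_n),\mathbb Q\big).$$ Let $X_1,X_2,\dots$ be i.i.d. with law $\mathbb P$ and $\widehat{\mathcal{GW}}_n=\widehat{\mathcal{GW}}_n(X_1,\dots,X_n)$. Given $X_1,\dots,X_n$, let $X_1^*,\dots,X_n^*$ be drawn independently and uniformly, with replacement, from $X_1,\dots,X_n$, and let $\widehat{\mathcal{GW}}{}_n^*=\widehat{\mathcal{GW}}_n(X_1^*,\dots,X_n^*)$.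 Let $\{(\kappa_k,r_k):k=1,\dots,d\}$ be an eigendecomposition of $\Xi^{1/2}\Sigma\,\Xi^{1/2}$ into orthonormal eigenpairs and $$\upsilon^2=4(\nu-\mu)^t\Sigma(\nu-\mu)+2\operatorname{tr}(\Sigma^2)+2\operatorname{tr}(\Sigma\,\Xi)-4\sum_{k=1}^d\kappa_k^{1/2}\,r_k^t\,\Xi^{-1/2}\Sigma\,\Xi^{1/2}r_k .$$ Then the $n$-out-of-$n$ bootstrap is consistent: $\sqrt n\,(\widehat{\mathcal{GW}}{}_n^*-\widehat{\mathcal{GW}}_n)\Rightarrow N(0,\upsilon^2)$ conditionally given $X_1,X_2,\dots$, in probability. That is, for every metric $\rho$ on the probability measures on $\mathbb R$ that induces the topology of weak convergence, $$\rho\Big(\mathcal L\big(\sqrt n\,(\widehat{\mathcal{GW}}{}_n^*-\widehat{\mathcal{GW}}_n)\,\big|\,X_1,\dots,X_n\big),\;N(0,\upsilon^2)\Big)\longrightarrow 0\quad\text{in probability as } n\to\infty .$$ -/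

import Mathlib

open MeasureTheory ProbabilityTheory Filter Topology
open scoped ENNReal NNReal Matrix MatrixOrder

noncomputable section

namespace GaussianWasserstein

/-- `π` is a coupling of `P` and `Q`: a measure on the product space with these marginals. For
probability measures `P`, `Q` it is automatically a probability measure. -/
def IsCoupling {E : Type*} [MeasurableSpace E] (π : Measure (E × E)) (P Q : Measure E) : Prop :=
  π.map Prod.fst = P ∧ π.map Prod.snd = Q

/-- The `p`-Wasserstein distance
`W_p(P, Q) = inf_π (∫ ‖x - y‖ ^ p π(dx, dy)) ^ (1 / p)`, with values in `[0, ∞]`. -/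
def wasserstein {E : Type*} [NormedAddCommGroup E] [MeasurableSpace E]
    (p : ℝ) (P Q : Measure E) : ℝ≥0∞ :=
  ⨅ (π : Measure (E × E)) (_ : IsCoupling π P Q), (∫⁻ z, ‖z.1 - z.2‖ₑ ^ p ∂π) ^ (1 / p)

/-- The squared `2`-Wasserstein distance `W_2²(P, Q)` as a real number (`W_2` is finite as soon as
`P` and `Q` are probability measures with finite second moments, such as Gaussian measures). -/
def sqWasserstein {E : Type*} [NormedAddCommGroup E] [MeasurableSpace E] (P Q : Measure E) : ℝ :=
  (wasserstein 2 P Q).toReal ^ 2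

/-- The sample mean `(1 / n) ∑ x_i`. -/
def sampleMean {d n : ℕ} (x : Fin n → EuclideanSpace ℝ (Fin d)) : EuclideanSpace ℝ (Fin d) :=
  (n : ℝ)⁻¹ • ∑ i, x i

/-- The sample covariance matrix `(1 / (n - 1)) ∑ (x_i - x̄) (x_i - x̄)ᵗ`. -/
def sampleCov {d n : ℕ} (x : Fin n → EuclideanSpace ℝ (Fin d)) : Matrix (Fin d) (Fin d) ℝ :=
  Matrix.of fun a b =>
    ((n : ℝ) - 1)⁻¹ * ∑ i, (x i a - sampleMean x a) * (x i b - sampleMean x b)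

/-- The Gaussian Wasserstein estimator: the squared `2`-Wasserstein distance between the normal
law with the sample mean and the sample covariance matrix of `x`, and the law `Q`. -/
def gwEstimator {d n : ℕ} (Q : Measure (EuclideanSpace ℝ (Fin d)))
    (x : Fin n → EuclideanSpace ℝ (Fin d)) : ℝ :=
  sqWasserstein (multivariateGaussian (sampleMean x) (sampleCov x)) Q

/-- The law of `n` independent uniform draws, with replacement, from `{0, …, n - 1}`. -/
def resampling (n : ℕ) : Measure (Fin n → Fin n) :=
  Measure.pi fun _ => uniformOn (Set.univ : Set (Fin n))

instance isProbabilityMeasure_resampling (n : ℕ) : IsProbabilityMeasure (resampling n) := by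
  rcases n with _ | n
  · exact ⟨by simp [resampling]⟩
  · have : IsProbabilityMeasure (uniformOn (Set.univ : Set (Fin (n + 1)))) :=
      isProbabilityMeasure_uniformOn Set.finite_univ Set.univ_nonempty
    unfold resampling
    infer_instance

/-- The conditional law, given the data `x = (x_1, …, x_n)`, of
`√n (GW*_n - GW_n)`, where `GW_n` is the Gaussian Wasserstein estimator of `x`, and `GW*_n` is the
one of the resampled data `x* = (x_{I 1}, …, x_{I n})`, with `I 1, …, I n` independent and uniform
on the indices. -/
def bootstrapLaw {d n : ℕ} (Q : Measure (EuclideanSpace ℝ (Fin d)))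
    (x : Fin n → EuclideanSpace ℝ (Fin d)) : ProbabilityMeasure ℝ :=
  ⟨(resampling n).map fun I => √(n : ℝ) * (gwEstimator Q (fun j => x (I j)) - gwEstimator Q x),
    Measure.isProbabilityMeasure_map (Measurable.of_discrete).aemeasurable⟩

/-- The normal law `N(0, v)` on `ℝ`, with variance `v ≥ 0`. -/
def centeredNormal (v : ℝ) : ProbabilityMeasure ℝ :=
  ⟨gaussianReal 0 v.toNNReal, inferInstance⟩

/-- `(κ, r)` is an eigendecomposition of the symmetric matrix `M`: the `r k` form an orthonormal
basis of eigenvectors, with eigenvalues `κ k`. -/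
def IsEigendecomposition {d : ℕ} (M : Matrix (Fin d) (Fin d) ℝ) (κ : Fin d → ℝ)
    (r : OrthonormalBasis (Fin d) ℝ (EuclideanSpace ℝ (Fin d))) : Prop :=
  ∀ k, M *ᵥ (r k).ofLp = κ k • (r k).ofLp

/-- The asymptotic variance
`υ² = 4 (ν - μ)ᵗ Σ (ν - μ) + 2 tr(Σ²) + 2 tr(Σ Ξ) - 4 ∑ₖ κₖ^{1/2} rₖᵗ Ξ^{-1/2} Σ Ξ^{1/2} rₖ`. -/
def asymptoticVariance {d : ℕ} (μ ν : EuclideanSpace ℝ (Fin d)) (S Ξ : Matrix (Fin d) (Fin d) ℝ)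
    (κ : Fin d → ℝ) (r : OrthonormalBasis (Fin d) ℝ (EuclideanSpace ℝ (Fin d))) : ℝ :=
  4 * ((ν - μ).ofLp ⬝ᵥ S *ᵥ (ν - μ).ofLp) + 2 * (S ^ 2).trace + 2 * (S * Ξ).trace
    - 4 * ∑ k, √(κ k) *
        ((r k).ofLp ⬝ᵥ ((CFC.sqrt Ξ)⁻¹ * S * CFC.sqrt Ξ) *ᵥ (r k).ofLp)

end GaussianWasserstein

end

noncomputable section

/-! The argument is the delta method for the bootstrap, with all limits taken along filters. For
positive definite S and Ξ there is a positive definite A with A S A = Ξ, and x ↦ ν + A (x - m)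
transports N(m, S) optimally to N(ν, Ξ). Duality with quadratic potentials gives W₂² = ‖m - ν‖² + tr
S + tr Ξ - 2 tr(A S) (`sqWasserstein_multivariateGaussian`).

No derivative of a matrix square root is needed. The function S ↦ 2 tr(A S) is concave with
supergradient A (`trace_sub_le_of_mul_mul_eq`), so its increment from S₂ to S₁ lies between tr(A₁
(S₁ - S₂)) and tr(A₂ (S₁ - S₂)). Since A depends continuously on S, this sandwich is a first order
expansion (`abs_sqWasserstein_sub_sub_le`). Hence √n (GW* - GW) differs by o_P(1) from the scaled
bootstrap deviation of the mean of g(x) = 2 (μ - ν)ᵗ (x - μ) + (x - μ)ᵗ (1 - A) (x - μ), as shown in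
`tendsto_gwEstimator_diff_sub`.

Given the data, that deviation is a sum of independent terms. Its characteristic function is an n-th
power, and a third order Taylor bound gives a normal limit (`tendsto_integral_resampling_exp`). The
limiting variance is Var g under N(μ, Σ), which equals υ² (`variance_influence`).

The bootstrap limit is proved for deterministic arrays of samples whose relevant moments converge.
The law of large numbers supplies these moments in probability, and only countably many are
involved, so the filter they define is countably generated and sequences suffice. -/

namespace GaussianWasserstein

/-! ### Convergence in probability for a family of measures -/

section InProbability

variable {ι : Type*} {Ω : ι → Type*} [∀ i, MeasurableSpace (Ω i)]

/-- The filter of the sets whose complements have `P i`-measure tending to `0` along `l`.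
Convergence along it is convergence in (outer) probability. -/
def inProbability (P : ∀ i, Measure (Ω i)) (l : Filter ι) : Filter (Σ i, Ω i) where
  sets := {A | Tendsto (fun i => P i {ω | (⟨i, ω⟩ : Σ i, Ω i) ∉ A}) l (𝓝 0)}
  univ_sets := by simp [tendsto_const_nhds]
  sets_of_superset {A B} hA hAB :=
    tendsto_of_tendsto_of_tendsto_of_le_of_le tendsto_const_nhds hA (fun _ => zero_le)
      fun _ => measure_mono fun _ h h' => h (hAB h')
  inter_sets {A B} hA hB := by
    have h : Tendsto (fun i => P i {ω | (⟨i, ω⟩ : Σ i, Ω i) ∉ A} +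
        P i {ω | (⟨i, ω⟩ : Σ i, Ω i) ∉ B}) l (𝓝 0) := by
      simpa using Tendsto.add hA hB
    refine tendsto_of_tendsto_of_tendsto_of_le_of_le tendsto_const_nhds h (fun _ => zero_le)
      fun i => (measure_mono ?_).trans (measure_union_le _ _)
    intro ω hω
    by_contra h'
    simp only [Set.mem_union, Set.mem_ofPred_eq, not_or, not_not] at h'
    exact hω h'

variable {P : ∀ i, Measure (Ω i)} {l : Filter ι}

lemma mem_inProbability {A : Set (Σ i, Ω i)} : A ∈ inProbability P l ↔
    Tendsto (fun i => P i {ω | (⟨i, ω⟩ : Σ i, Ω i) ∉ A}) l (𝓝 0) := Iff.rfl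

lemma tendsto_fst_inProbability : Tendsto Sigma.fst (inProbability P l) l := by
  intro B hB
  rw [mem_map, mem_inProbability]
  refine (tendsto_congr' ?_).2 tendsto_const_nhds
  filter_upwards [hB] with i hi
  simp [hi]

lemma tendsto_inProbability_iff {V : (Σ i, Ω i) → ℝ} {c : ℝ} :
    Tendsto V (inProbability P l) (𝓝 c) ↔
      ∀ ε > 0, Tendsto (fun i => P i {ω | ε ≤ |V ⟨i, ω⟩ - c|}) l (𝓝 0) := by
  rw [Metric.tendsto_nhds]
  refine forall₂_congr fun ε _ => ?_
  change Tendsto _ _ _ ↔ _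
  simp [Real.dist_eq, not_lt]

/-- A family of random variables with bounded second moments. -/
def SqBounded (P : ∀ i, Measure (Ω i)) (l : Filter ι) (V : (Σ i, Ω i) → ℝ) : Prop :=
  ∃ C : ℝ, ∀ᶠ i in l, ∫⁻ ω, ENNReal.ofReal (V ⟨i, ω⟩ ^ 2) ∂P i ≤ ENNReal.ofReal C

lemma measure_le_of_lintegral_sq_le {α : Type*} [MeasurableSpace α] {μ : Measure α} {f : α → ℝ}
    {C K : ℝ} (hf : Measurable f) (h : ∫⁻ ω, ENNReal.ofReal (f ω ^ 2) ∂μ ≤ ENNReal.ofReal C)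
    (hK : 0 < K) : μ {ω | K ≤ |f ω|} ≤ ENNReal.ofReal (C / K ^ 2) := by
  have h1 := mul_meas_ge_le_lintegral₀ (μ := μ) (f := fun ω => ENNReal.ofReal (f ω ^ 2))
    (by fun_prop) (ENNReal.ofReal (K ^ 2))
  have h2 : {ω | K ≤ |f ω|} = {ω | ENNReal.ofReal (K ^ 2) ≤ ENNReal.ofReal (f ω ^ 2)} := by
    ext ω
    simp only [Set.mem_ofPred_eq]
    rw [ENNReal.ofReal_le_ofReal_iff (sq_nonneg _), ← sq_abs (f ω),
      sq_le_sq₀ hK.le (abs_nonneg _)]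
  rw [h2, ENNReal.ofReal_div_of_pos (by positivity), ENNReal.le_div_iff_mul_le
    (Or.inl (by simpa using hK.ne')) (Or.inl ENNReal.ofReal_ne_top), mul_comm]
  exact h1.trans h

/-- This is o_P(1) · O_P(1) = o_P(1): by Chebyshev, bounded second moments make V tight. -/
lemma SqBounded.mul_tendsto_zero {U V : (Σ i, Ω i) → ℝ} (hV : SqBounded P l V)
    (hVm : ∀ i, Measurable fun ω => V ⟨i, ω⟩)
    (hU : Tendsto U (inProbability P l) (𝓝 0)) :
    Tendsto (fun z => U z * V z) (inProbability P l) (𝓝 0) := by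
  obtain ⟨C, hC⟩ := hV
  rw [tendsto_inProbability_iff]
  intro ε hε
  rw [tendsto_inProbability_iff] at hU
  rw [ENNReal.tendsto_nhds_zero]
  intro δ hδ
  obtain ⟨K, hK, hKδ⟩ : ∃ K : ℝ, 0 < K ∧ ENNReal.ofReal (C / K ^ 2) ≤ δ / 2 := by
    have h1 : Tendsto (fun K : ℝ => ENNReal.ofReal (C / K ^ 2)) atTop (𝓝 0) := by
      rw [← ENNReal.ofReal_zero]
      exact (ENNReal.continuous_ofReal.tendsto 0).comp
        (tendsto_const_nhds.div_atTop (tendsto_pow_atTop two_ne_zero))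
    have h2 := (ENNReal.tendsto_nhds_zero.1 h1 (δ / 2) (ENNReal.half_pos hδ.ne')).and
      (eventually_gt_atTop 0)
    obtain ⟨K, hK⟩ := h2.exists
    exact ⟨K, hK.2, hK.1⟩
  filter_upwards [hC, ENNReal.tendsto_nhds_zero.1 (hU (ε / K) (by positivity)) (δ / 2)
    (ENNReal.half_pos hδ.ne')] with i hi1 hi2
  calc P i {ω | ε ≤ |U ⟨i, ω⟩ * V ⟨i, ω⟩ - 0|}
      ≤ P i ({ω | ε / K ≤ |U ⟨i, ω⟩ - 0|} ∪ {ω | K ≤ |V ⟨i, ω⟩|}) := by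
        refine measure_mono fun ω hω => ?_
        by_contra h
        simp only [Set.mem_union, Set.mem_ofPred_eq, not_or, not_le, sub_zero, abs_mul] at h hω
        have := mul_lt_mul'' h.1 h.2 (abs_nonneg _) (abs_nonneg _)
        rw [div_mul_cancel₀ _ hK.ne'] at this
        linarith
    _ ≤ δ / 2 + δ / 2 := (measure_union_le _ _).trans
        (add_le_add hi2 ((measure_le_of_lintegral_sq_le (hVm i) hi1 hK).trans hKδ))
    _ = δ := ENNReal.add_halves δ

lemma norm_exp_mul_I_sub_exp_mul_I_le (a b : ℝ) :
    ‖Complex.exp (a * Complex.I) - Complex.exp (b * Complex.I)‖ ≤ |a - b| := by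
  have h : Complex.exp (a * Complex.I) - Complex.exp (b * Complex.I) =
      Complex.exp (b * Complex.I) * (Complex.exp (Complex.I * ((a - b : ℝ) : ℂ)) - 1) := by
    rw [mul_sub, ← Complex.exp_add]
    push_cast
    ring_nf
  rw [h, norm_mul, Complex.norm_exp_ofReal_mul_I, one_mul]
  exact Real.norm_exp_I_mul_ofReal_sub_one_le

/-- Slutsky's lemma for characteristic functions. -/
lemma tendsto_integral_exp_of_tendsto_sub [∀ i, IsProbabilityMeasure (P i)]
    {U V : (Σ i, Ω i) → ℝ} (hUm : ∀ i, Measurable fun ω => U ⟨i, ω⟩)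
    (hVm : ∀ i, Measurable fun ω => V ⟨i, ω⟩)
    (h : Tendsto (fun z => U z - V z) (inProbability P l) (𝓝 0)) (t : ℝ) {c : ℂ}
    (hV : Tendsto (fun i => ∫ ω, Complex.exp ((t * V ⟨i, ω⟩ : ℝ) * Complex.I) ∂P i) l (𝓝 c)) :
    Tendsto (fun i => ∫ ω, Complex.exp ((t * U ⟨i, ω⟩ : ℝ) * Complex.I) ∂P i) l (𝓝 c) := by
  have hint : ∀ (W : (Σ i, Ω i) → ℝ), (∀ i, Measurable fun ω => W ⟨i, ω⟩) → ∀ i,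
      Integrable (fun ω => Complex.exp ((t * W ⟨i, ω⟩ : ℝ) * Complex.I)) (P i) := by
    intro W hW i
    refine Integrable.of_bound (C := 1) ?_ (ae_of_all _ fun ω => ?_)
    · exact (Complex.measurable_exp.comp
        ((Complex.measurable_ofReal.comp ((hW i).const_mul t)).mul_const _)).aestronglyMeasurable
    · rw [Complex.norm_exp_ofReal_mul_I]
  suffices H : Tendsto (fun i => ∫ ω, Complex.exp ((t * U ⟨i, ω⟩ : ℝ) * Complex.I) ∂P i -
      ∫ ω, Complex.exp ((t * V ⟨i, ω⟩ : ℝ) * Complex.I) ∂P i) l (𝓝 0) by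
    simpa using H.add hV
  rw [tendsto_inProbability_iff] at h
  rw [Metric.tendsto_nhds]
  intro ε hε
  -- Where |U - V| < δ the integrands differ by at most |t| δ ≤ ε / 2. Elsewhere they differ by at
  -- most 2, on an event of probability below ε / 4.
  set δ : ℝ := ε / (2 * (|t| + 1)) with hδ
  have hδ0 : 0 < δ := by positivity
  have h1 : Tendsto (fun i => (P i {ω | δ ≤ |U ⟨i, ω⟩ - V ⟨i, ω⟩|}).toReal) l (𝓝 0) := by
    have := (ENNReal.tendsto_toReal ENNReal.zero_ne_top).comp (h δ hδ0)
    simpa [Function.comp_def] using this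
  filter_upwards [h1.eventually_lt_const (show (0 : ℝ) < ε / 4 by positivity)] with i hi
  rw [dist_zero_right, ← integral_sub (hint U hUm i) (hint V hVm i)]
  have hms : MeasurableSet {ω | δ ≤ |U ⟨i, ω⟩ - V ⟨i, ω⟩|} := by
    exact measurableSet_le measurable_const ((hUm i).sub (hVm i)).abs
  calc ‖∫ ω, (Complex.exp ((t * U ⟨i, ω⟩ : ℝ) * Complex.I) -
        Complex.exp ((t * V ⟨i, ω⟩ : ℝ) * Complex.I)) ∂P i‖
      ≤ ∫ ω, (|t| * δ + {ω | δ ≤ |U ⟨i, ω⟩ - V ⟨i, ω⟩|}.indicator (fun _ => (2 : ℝ)) ω) ∂P i := by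
        refine norm_integral_le_of_norm_le ((integrable_const _).add
          ((integrable_const _).indicator hms)) (ae_of_all _ fun ω => ?_)
        by_cases hω : ω ∈ {ω | δ ≤ |U ⟨i, ω⟩ - V ⟨i, ω⟩|}
        · rw [Set.indicator_of_mem hω]
          refine (norm_sub_le _ _).trans ?_
          rw [Complex.norm_exp_ofReal_mul_I, Complex.norm_exp_ofReal_mul_I]
          have : 0 ≤ |t| * δ := by positivity
          linarith
        · rw [Set.indicator_of_notMem hω, add_zero]
          refine (norm_exp_mul_I_sub_exp_mul_I_le _ _).trans ?_
          rw [← mul_sub, abs_mul]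
          simp only [Set.mem_ofPred_eq, not_le] at hω
          gcongr
    _ = |t| * δ + 2 * (P i {ω | δ ≤ |U ⟨i, ω⟩ - V ⟨i, ω⟩|}).toReal := by
        rw [integral_add (integrable_const _) ((integrable_const _).indicator hms),
          integral_indicator_const _ hms]
        simp [Measure.real, mul_comm]
    _ < ε := by
        have : |t| * δ ≤ ε / 2 := by
          rw [hδ, mul_div_assoc', div_le_iff₀ (by positivity)]
          nlinarith [abs_nonneg t]
        linarith

end InProbability

/-! ### Means under resampling -/

/-- The mean of finitely many real numbers. -/
def mean {n : ℕ} (f : Fin n → ℝ) : ℝ := (n : ℝ)⁻¹ * ∑ i, f i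

lemma mean_add {n : ℕ} (f g : Fin n → ℝ) : mean (fun i => f i + g i) = mean f + mean g := by
  simp [mean, Finset.sum_add_distrib, mul_add]

lemma mean_sub {n : ℕ} (f g : Fin n → ℝ) : mean (fun i => f i - g i) = mean f - mean g := by
  simp [mean, Finset.sum_sub_distrib, mul_sub]

lemma mean_const_mul {n : ℕ} (c : ℝ) (f : Fin n → ℝ) :
    mean (fun i => c * f i) = c * mean f := by
  simp only [mean, ← Finset.mul_sum]
  ring

lemma mean_sum {n : ℕ} {κ : Type*} (s : Finset κ) (f : κ → Fin n → ℝ) :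
    mean (fun i => ∑ k ∈ s, f k i) = ∑ k ∈ s, mean (f k) := by
  simp only [mean]
  rw [Finset.sum_comm, Finset.mul_sum]

lemma mean_const {n : ℕ} (hn : n ≠ 0) (c : ℝ) : mean (fun _ : Fin n => c) = c := by
  simp [mean, hn]

lemma mean_mono {n : ℕ} {f g : Fin n → ℝ} (h : ∀ i, f i ≤ g i) : mean f ≤ mean g :=
  mul_le_mul_of_nonneg_left (Finset.sum_le_sum fun i _ => h i) (by positivity)

lemma isProbabilityMeasure_uniformOn_fin {n : ℕ} (hn : n ≠ 0) :
    IsProbabilityMeasure (uniformOn (Set.univ : Set (Fin n))) := by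
  have : NeZero n := ⟨hn⟩
  exact isProbabilityMeasure_uniformOn Set.finite_univ Set.univ_nonempty

lemma integral_uniformOn_univ {F : Type*} [NormedAddCommGroup F] [NormedSpace ℝ F]
    [CompleteSpace F] {n : ℕ} (hn : n ≠ 0) (f : Fin n → F) :
    ∫ i, f i ∂(uniformOn (Set.univ : Set (Fin n))) = (n : ℝ)⁻¹ • ∑ i, f i := by
  have := isProbabilityMeasure_uniformOn_fin hn
  rw [integral_fintype Integrable.of_finite, Finset.smul_sum]
  refine Finset.sum_congr rfl fun i _ => ?_
  congr 1
  rw [Measure.real, uniformOn_univ]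
  simp

lemma integral_resampling_eval {n : ℕ} (hn : n ≠ 0) (f : Fin n → ℝ) (j : Fin n) :
    ∫ I, f (I j) ∂(resampling n) = mean f := by
  have := isProbabilityMeasure_uniformOn_fin hn
  rw [resampling, integral_comp_eval (μ := fun _ => uniformOn (Set.univ : Set (Fin n))) (f := f)
    (Measurable.of_discrete).aestronglyMeasurable, integral_uniformOn_univ hn, smul_eq_mul, mean]

lemma integral_resampling_mean {n : ℕ} (hn : n ≠ 0) (f : Fin n → ℝ) :
    ∫ I, mean (fun j => f (I j)) ∂(resampling n) = mean f := by
  simp only [mean]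
  rw [integral_const_mul, integral_finsetSum _ fun _ _ => Integrable.of_finite]
  simp_rw [integral_resampling_eval hn f, Finset.sum_const]
  simp [mean, hn]

/-- The left side is n times the variance of a mean of n independent draws, hence the variance of a
single draw. -/
lemma integral_resampling_sq_le {n : ℕ} (hn : n ≠ 0) (f : Fin n → ℝ) :
    ∫ I, (√(n : ℝ) * (mean (fun j => f (I j)) - mean f)) ^ 2 ∂(resampling n) ≤
      mean (fun i => f i ^ 2) := by
  have := isProbabilityMeasure_uniformOn_fin hn
  have hn0 : (n : ℝ) ≠ 0 := by exact_mod_cast hn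
  have h1 : ∫ I, (mean (fun j => f (I j)) - mean f) ^ 2 ∂(resampling n) =
      Var[fun I => mean (fun j => f (I j)); resampling n] := by
    rw [variance_eq_integral (Measurable.of_discrete).aemeasurable, integral_resampling_mean hn]
  have h2 : Var[fun I : Fin n → Fin n => mean (fun j => f (I j)); resampling n] =
      (n : ℝ)⁻¹ * Var[f; uniformOn (Set.univ : Set (Fin n))] := by
    have h3 := variance_sum_pi (μ := fun _ : Fin n => uniformOn (Set.univ : Set (Fin n)))
      (X := fun _ : Fin n => f) (fun _ => MemLp.of_discrete)
    have h4 : (fun I : Fin n → Fin n => mean (fun j => f (I j))) =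
        fun I => (n : ℝ)⁻¹ * (∑ j, fun I : Fin n → Fin n => f (I j)) I := by
      ext I
      simp [mean]
    rw [h4, variance_const_mul, resampling, h3]
    simp
    field_simp
  simp_rw [mul_pow, Real.sq_sqrt (Nat.cast_nonneg n)]
  rw [integral_const_mul, h1, h2, mul_inv_cancel_left₀ hn0]
  refine (variance_le_expectation_sq (Measurable.of_discrete).aestronglyMeasurable).trans ?_
  rw [integral_uniformOn_univ hn]
  rfl

lemma lintegral_resampling_sq_le {n : ℕ} (hn : n ≠ 0) (f : Fin n → ℝ) :
    ∫⁻ I, ENNReal.ofReal ((√(n : ℝ) * (mean (fun j => f (I j)) - mean f)) ^ 2) ∂(resampling n) ≤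
      ENNReal.ofReal (mean (fun i => f i ^ 2)) := by
  rw [← ofReal_integral_eq_lintegral_ofReal Integrable.of_finite
    (ae_of_all _ fun _ => sq_nonneg _)]
  exact ENNReal.ofReal_le_ofReal (integral_resampling_sq_le hn f)

/-- The draws are independent and identically distributed, so the characteristic function factors
into equal terms. -/
lemma integral_resampling_exp {n : ℕ} (hn : n ≠ 0) (f : Fin n → ℝ) (t : ℝ) :
    ∫ I, Complex.exp ((t * (√(n : ℝ) * (mean (fun j => f (I j)) - mean f)) : ℝ) * Complex.I)
        ∂(resampling n) =
      ((n : ℝ)⁻¹ • ∑ i, Complex.exp (((t / √(n : ℝ)) * (f i - mean f) : ℝ) * Complex.I)) ^ n := by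
  have := isProbabilityMeasure_uniformOn_fin hn
  have hn0 : (0 : ℝ) < n := by positivity
  have h1 : ∀ I : Fin n → Fin n,
      Complex.exp ((t * (√(n : ℝ) * (mean (fun j => f (I j)) - mean f)) : ℝ) * Complex.I) =
      ∏ j, Complex.exp (((t / √(n : ℝ)) * (f (I j) - mean f) : ℝ) * Complex.I) := by
    intro I
    rw [← Complex.exp_sum, ← Finset.sum_mul, ← Complex.ofReal_sum]
    congr 3
    rw [← Finset.mul_sum, Finset.sum_sub_distrib]
    simp only [Finset.sum_const, Finset.card_univ, Fintype.card_fin, nsmul_eq_mul]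
    have hs : (√(n : ℝ)) ^ 2 = n := Real.sq_sqrt hn0.le
    have hs0 : √(n : ℝ) ≠ 0 := by positivity
    have h5 : ∑ j, f (I j) = n * mean (fun j => f (I j)) := by
      rw [mean, mul_inv_cancel_left₀ hn0.ne']
    rw [h5]
    field_simp
    rw [hs]
    ring
  simp_rw [h1]
  rw [resampling, integral_fintype_prod_eq_prod
    (f := fun _ i => Complex.exp (((t / √(n : ℝ)) * (f i - mean f) : ℝ) * Complex.I))]
  simp_rw [integral_uniformOn_univ hn]
  simp

/-! ### The central limit theorem for the bootstrap mean of an array of numbers -/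

/-- The constant is crude: for |u| > 1 the terms are bounded separately by 1 + 1 + |u| + |u|² / 2 ≤
4 |u|³. -/
lemma norm_exp_mul_I_sub_taylor_le (u : ℝ) :
    ‖Complex.exp (u * Complex.I) - (1 + u * Complex.I - (u : ℂ) ^ 2 / 2)‖ ≤ 4 * |u| ^ 3 := by
  have hnorm : ‖(u : ℂ) * Complex.I‖ = |u| := by simp
  rcases le_or_gt |u| 1 with hu | hu
  · have h := Complex.exp_bound (x := u * Complex.I) (by rwa [hnorm]) (n := 3) (by norm_num)
    have h2 : ∑ m ∈ Finset.range 3, ((u : ℂ) * Complex.I) ^ m / (m.factorial : ℂ) =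
        1 + u * Complex.I - (u : ℂ) ^ 2 / 2 := by
      simp [Finset.sum_range_succ, mul_pow, Complex.I_sq]
      ring
    rw [h2, hnorm] at h
    refine h.trans ?_
    rw [mul_comm]
    refine mul_le_mul_of_nonneg_right ?_ (by positivity)
    norm_num [Nat.factorial]
  · have h3 : ‖(1 : ℂ) + u * Complex.I - (u : ℂ) ^ 2 / 2‖ ≤ 1 + |u| + |u| ^ 2 / 2 := by
      refine (norm_sub_le _ _).trans (add_le_add ((norm_add_le _ _).trans ?_) ?_)
      · simp
      · simp
    refine (norm_sub_le _ _).trans ?_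
    rw [Complex.norm_exp_ofReal_mul_I]
    have h4 : |u| ≤ |u| ^ 3 := le_self_pow₀ hu.le (by norm_num)
    have h5 : |u| ^ 2 ≤ |u| ^ 3 := pow_le_pow_right₀ hu.le (by norm_num)
    linarith

lemma norm_pow_sub_pow_le_of_norm_le_one {a b : ℂ} (ha : ‖a‖ ≤ 1) (hb : ‖b‖ ≤ 1) (n : ℕ) :
    ‖a ^ n - b ^ n‖ ≤ n * ‖a - b‖ := by
  induction n with
  | zero => simp
  | succ n ih =>
    have h : a ^ (n + 1) - b ^ (n + 1) = a ^ n * (a - b) + (a ^ n - b ^ n) * b := by ring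
    rw [h]
    refine (norm_add_le _ _).trans ?_
    rw [norm_mul, norm_mul, norm_pow]
    have h1 : ‖a‖ ^ n ≤ 1 := pow_le_one₀ (norm_nonneg _) ha
    have h2 : ‖a‖ ^ n * ‖a - b‖ ≤ 1 * ‖a - b‖ := by gcongr
    have h3 : ‖a ^ n - b ^ n‖ * ‖b‖ ≤ n * ‖a - b‖ * 1 := by gcongr
    push_cast
    linarith

lemma abs_sub_pow_three_le (a b : ℝ) : |a - b| ^ 3 ≤ 4 * |a| ^ 3 + 4 * |b| ^ 3 := by
  have h1 : |a - b| ≤ |a| + |b| := abs_sub a b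
  have h2 : |a - b| ^ 3 ≤ (|a| + |b|) ^ 3 := by gcongr
  have ha := abs_nonneg a
  have hb := abs_nonneg b
  -- With p = |a| and q = |b|: 4 p³ + 4 q³ - (p + q)³ = 3 (p + q) (p - q)².
  nlinarith [mul_nonneg (add_nonneg ha hb) (sq_nonneg (|a| - |b|))]

lemma norm_mean_exp_sub_le {n : ℕ} (hn : n ≠ 0) (u : Fin n → ℝ) (hu : mean u = 0) :
    ‖(n : ℝ)⁻¹ • ∑ i, Complex.exp (u i * Complex.I) -
      ((1 - mean (fun i => u i ^ 2) / 2 : ℝ) : ℂ)‖ ≤ 4 * mean (fun i => |u i| ^ 3) := by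
  have h1 : ((1 - mean (fun i => u i ^ 2) / 2 : ℝ) : ℂ) =
      (n : ℝ)⁻¹ • ∑ i, (1 + u i * Complex.I - (u i : ℂ) ^ 2 / 2) := by
    have h2 : ∑ i, u i = 0 := by
      simpa [mean, hn] using hu
    rw [Finset.sum_sub_distrib, Finset.sum_add_distrib, ← Finset.sum_mul, ← Complex.ofReal_sum, h2,
      ← Finset.sum_div, Complex.real_smul]
    simp only [mean, Finset.sum_const, Finset.card_univ, Fintype.card_fin, nsmul_eq_mul]
    have : (n : ℂ) ≠ 0 := by exact_mod_cast hn
    push_cast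
    field_simp
    ring
  rw [h1, ← smul_sub, ← Finset.sum_sub_distrib, norm_smul, norm_inv, Real.norm_natCast, mean,
    mul_left_comm, Finset.mul_sum]
  refine mul_le_mul_of_nonneg_left ((norm_sum_le _ _).trans
    (Finset.sum_le_sum fun i _ => norm_exp_mul_I_sub_taylor_le _)) (by positivity)

/-- The n-th powers of the one-draw characteristic function and of exp(-w), w = t² v / (2 n), are at
most n times as far apart as their bases. Both bases are 1 - w up to a third moment term and w²
respectively; the second bound needs w ≤ 1. The factor 16 is 4 from the Taylor bound times 4 from
centering the third moment. -/
lemma norm_resampling_exp_sub_le {n : ℕ} (hn : n ≠ 0) (y : Fin n → ℝ) (t v : ℝ)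
    (hv : v = mean (fun i => y i ^ 2) - mean y ^ 2)
    (hw : t ^ 2 * v / (2 * n) ≤ 1) :
    ‖∫ I, Complex.exp ((t * (√(n : ℝ) * (mean (fun j => y (I j)) - mean y)) : ℝ) * Complex.I)
        ∂(resampling n) - ((Real.exp (-(t ^ 2 * v / 2)) : ℝ) : ℂ)‖ ≤
      16 * |t| ^ 3 * (mean (fun i => |y i| ^ 3) + |mean y| ^ 3) * (√(n : ℝ))⁻¹ +
        (t ^ 2 * v / 2) ^ 2 * (n : ℝ)⁻¹ := by
  have hn0 : (0 : ℝ) < n := by positivity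
  have hs0 : (0 : ℝ) < √(n : ℝ) := by positivity
  have hs : (√(n : ℝ)) ^ 2 = n := Real.sq_sqrt hn0.le
  have hvar : mean (fun i => (y i - mean y) ^ 2) = v := by
    have h1 : (fun i => (y i - mean y) ^ 2) =
        fun i => (y i ^ 2 - 2 * mean y * y i) + mean y ^ 2 := by
      ext i; ring
    rw [h1, mean_add, mean_sub, mean_const_mul, mean_const hn, hv]
    ring
  have hv0 : 0 ≤ v := by
    rw [← hvar, mean]
    positivity
  set u : Fin n → ℝ := fun i => (t / √(n : ℝ)) * (y i - mean y) with hu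
  have hu0 : mean u = 0 := by
    rw [hu, mean_const_mul, mean_sub, mean_const hn]
    simp
  have hu2 : mean (fun i => u i ^ 2) = t ^ 2 * v / n := by
    simp_rw [hu, mul_pow]
    rw [mean_const_mul, hvar, div_pow, hs]
    ring
  have hu3 : mean (fun i => |u i| ^ 3) ≤
      |t| ^ 3 * (√(n : ℝ))⁻¹ * (n : ℝ)⁻¹ * (4 * (mean (fun i => |y i| ^ 3) + |mean y| ^ 3)) := by
    have h1 : ∀ i, |u i| ^ 3 = |t| ^ 3 * (√(n : ℝ))⁻¹ * (n : ℝ)⁻¹ * |y i - mean y| ^ 3 := by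
      intro i
      rw [hu, abs_mul, mul_pow, abs_div, abs_of_pos hs0, div_pow, pow_succ (√(n : ℝ)) 2, hs]
      field_simp
    simp_rw [h1]
    rw [mean_const_mul]
    refine mul_le_mul_of_nonneg_left ?_ (by positivity)
    refine (mean_mono fun i => abs_sub_pow_three_le (y i) (mean y)).trans_eq ?_
    rw [mean_add, mean_const_mul, mean_const hn]
    ring
  rw [integral_resampling_exp hn]
  set a : ℂ := (n : ℝ)⁻¹ • ∑ i, Complex.exp ((u i : ℝ) * Complex.I) with ha
  set w : ℝ := t ^ 2 * v / (2 * n) with hwdef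
  have hw0 : 0 ≤ w := by positivity
  have hb : ((Real.exp (-(t ^ 2 * v / 2)) : ℝ) : ℂ) = ((Real.exp (-w) : ℝ) : ℂ) ^ n := by
    rw [← Complex.ofReal_pow, ← Real.exp_nat_mul, hwdef]
    congr 2
    field_simp
  have ha1 : ‖a‖ ≤ 1 := by
    rw [ha, norm_smul, norm_inv, Real.norm_natCast]
    calc (n : ℝ)⁻¹ * ‖∑ i, Complex.exp ((u i : ℝ) * Complex.I)‖
        ≤ (n : ℝ)⁻¹ * ∑ _i : Fin n, (1 : ℝ) := by
          refine mul_le_mul_of_nonneg_left ((norm_sum_le _ _).trans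
            (Finset.sum_le_sum fun i _ => ?_)) (by positivity)
          rw [Complex.norm_exp_ofReal_mul_I]
      _ = 1 := by simp [hn]
  have hb1 : ‖((Real.exp (-w) : ℝ) : ℂ)‖ ≤ 1 := by
    rw [Complex.norm_real, Real.norm_eq_abs, Real.abs_exp]
    exact Real.exp_le_one_iff.2 (by linarith)
  have hab : ‖a - ((Real.exp (-w) : ℝ) : ℂ)‖ ≤ 4 * mean (fun i => |u i| ^ 3) + w ^ 2 := by
    have h1 := norm_mean_exp_sub_le hn u hu0
    have h2 := Real.norm_exp_sub_one_sub_id_le (x := -w)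
      (by rw [norm_neg, Real.norm_eq_abs, abs_of_nonneg hw0]; exact hw)
    have h3 : (1 - mean (fun i => u i ^ 2) / 2 : ℝ) = 1 - w := by
      rw [hu2, hwdef]
      ring
    rw [h3] at h1
    have h4 : a - ((Real.exp (-w) : ℝ) : ℂ) =
        (a - ((1 - w : ℝ) : ℂ)) - ((Real.exp (-w) - 1 - -w : ℝ) : ℂ) := by
      push_cast
      ring
    rw [h4]
    refine (norm_sub_le _ _).trans (add_le_add h1 ?_)
    rw [Complex.norm_real]
    refine h2.trans_eq ?_
    rw [norm_neg, Real.norm_eq_abs, sq_abs]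
  rw [hb]
  refine (norm_pow_sub_pow_le_of_norm_le_one ha1 hb1 n).trans ?_
  calc (n : ℝ) * ‖a - ((Real.exp (-w) : ℝ) : ℂ)‖
      ≤ n * (4 * (|t| ^ 3 * (√(n : ℝ))⁻¹ * (n : ℝ)⁻¹ *
          (4 * (mean (fun i => |y i| ^ 3) + |mean y| ^ 3))) + w ^ 2) := by
        refine mul_le_mul_of_nonneg_left (hab.trans ?_) hn0.le
        gcongr
    _ = _ := by
        rw [hwdef]
        field_simp
        ring

/-- Conditional central limit theorem for the bootstrap mean. -/
lemma tendsto_integral_resampling_exp {n : ℕ → ℕ} (hn : Tendsto n atTop atTop)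
    (y : ∀ k, Fin (n k) → ℝ) {c s m : ℝ}
    (h1 : Tendsto (fun k => mean (y k)) atTop (𝓝 c))
    (h2 : Tendsto (fun k => mean (fun i => y k i ^ 2)) atTop (𝓝 s))
    (h3 : Tendsto (fun k => mean (fun i => |y k i| ^ 3)) atTop (𝓝 m)) (t : ℝ) :
    Tendsto (fun k => ∫ I, Complex.exp ((t * (√(n k : ℝ) *
      (mean (fun j => y k (I j)) - mean (y k))) : ℝ) * Complex.I) ∂(resampling (n k))) atTop
      (𝓝 ((Real.exp (-(t ^ 2 * (s - c ^ 2) / 2)) : ℝ) : ℂ)) := by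
  have hninv : Tendsto (fun k => ((n k : ℝ))⁻¹) atTop (𝓝 0) :=
    tendsto_inv_atTop_zero.comp (tendsto_natCast_atTop_atTop.comp hn)
  have hsinv : Tendsto (fun k => (√(n k : ℝ))⁻¹) atTop (𝓝 0) :=
    tendsto_inv_atTop_zero.comp (Real.tendsto_sqrt_atTop.comp (tendsto_natCast_atTop_atTop.comp hn))
  have hv := h2.sub (h1.pow 2)
  have hlim : Tendsto (fun k => ((Real.exp
      (-(t ^ 2 * (mean (fun i => y k i ^ 2) - mean (y k) ^ 2) / 2)) : ℝ) : ℂ)) atTop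
      (𝓝 ((Real.exp (-(t ^ 2 * (s - c ^ 2) / 2)) : ℝ) : ℂ)) :=
    (Complex.continuous_ofReal.tendsto _).comp ((Real.continuous_exp.tendsto _).comp
      (((hv.const_mul (t ^ 2)).div_const 2).neg))
  have hbound := ((((h3.add (h1.abs.pow 3)).const_mul (16 * |t| ^ 3)).mul hsinv).add
    ((((hv.const_mul (t ^ 2)).div_const 2).pow 2).mul hninv))
  have hw : Tendsto (fun k => t ^ 2 * (mean (fun i => y k i ^ 2) - mean (y k) ^ 2) / (2 * n k))
      atTop (𝓝 0) := by
    have := ((hv.const_mul (t ^ 2)).div_const 2).mul hninv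
    rw [mul_zero] at this
    refine this.congr fun k => ?_
    rw [← div_eq_mul_inv, div_div]
  simp only [mul_zero, add_zero] at hbound
  have hdiff := squeeze_zero_norm' (f := fun k => ∫ I, Complex.exp ((t * (√(n k : ℝ) *
      (mean (fun j => y k (I j)) - mean (y k))) : ℝ) * Complex.I) ∂(resampling (n k)) -
      ((Real.exp (-(t ^ 2 * (mean (fun i => y k i ^ 2) - mean (y k) ^ 2) / 2)) : ℝ) : ℂ)) ?_ hbound
  · simpa using hdiff.add hlim
  · filter_upwards [hn.eventually_ne_atTop 0, hw.eventually_le_const zero_lt_one] with k hk hwk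
    exact norm_resampling_exp_sub_le hk (y k) t _ rfl hwk

/-! ### The matrix of the optimal transport map between Gaussian laws -/

section Matrices

variable {d : ℕ}

lemma posDef_sqrt {S : Matrix (Fin d) (Fin d) ℝ} (hS : S.PosDef) : (CFC.sqrt S).PosDef :=
  Matrix.isStrictlyPositive_iff_posDef.1 (hS.isStrictlyPositive.sqrt S)

lemma sqrt_mul_sqrt {S : Matrix (Fin d) (Fin d) ℝ} (hS : S.PosSemidef) :
    CFC.sqrt S * CFC.sqrt S = S :=
  CFC.sqrt_mul_sqrt_self S hS.nonneg

lemma posSemidef_conj {S R : Matrix (Fin d) (Fin d) ℝ} (hS : S.PosSemidef) (hR : R.IsHermitian) :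
    (R * S * R).PosSemidef := by
  have h := hS.mul_mul_conjTranspose_same R
  rwa [hR.eq] at h

lemma posDef_conj {S R : Matrix (Fin d) (Fin d) ℝ} (hS : S.PosDef) (hR : R.PosDef) :
    (R * S * R).PosDef := by
  have h := hS.mul_mul_conjTranspose_same (B := R) (Matrix.vecMul_injective_of_isUnit hR.isUnit)
  rwa [hR.isHermitian.eq] at h

lemma trace_mul_nonneg {S R : Matrix (Fin d) (Fin d) ℝ} (hR : R.PosSemidef) (hS : S.PosSemidef) :
    0 ≤ (R * S).trace := by
  rw [← sqrt_mul_sqrt hS, ← mul_assoc, Matrix.trace_mul_comm, ← mul_assoc]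
  exact (posSemidef_conj hR (Matrix.nonneg_iff_posSemidef.1 (CFC.sqrt_nonneg S)).1).trace_nonneg

/-- The matrix `A = Ξ^{1/2} (Ξ^{1/2} S Ξ^{1/2})^{-1/2} Ξ^{1/2}` of the optimal transport map from
`N(0, S)` to `N(0, Ξ)`. -/
def otMatrix (Ξ S : Matrix (Fin d) (Fin d) ℝ) : Matrix (Fin d) (Fin d) ℝ :=
  CFC.sqrt Ξ * (CFC.sqrt (CFC.sqrt Ξ * S * CFC.sqrt Ξ))⁻¹ * CFC.sqrt Ξ

variable {Ξ S : Matrix (Fin d) (Fin d) ℝ}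

lemma posDef_otMatrix (hΞ : Ξ.PosDef) (hS : S.PosDef) : (otMatrix Ξ S).PosDef :=
  posDef_conj (posDef_sqrt (posDef_conj hS (posDef_sqrt hΞ))).inv (posDef_sqrt hΞ)

/-- The closed form of the distance and the tangent inequality use `otMatrix` only through this
equation and positivity. -/
lemma otMatrix_mul_mul_otMatrix (hΞ : Ξ.PosDef) (hS : S.PosDef) :
    otMatrix Ξ S * S * otMatrix Ξ S = Ξ := by
  have hM := posDef_conj hS (posDef_sqrt hΞ)
  have hR := posDef_sqrt hM
  have h1 := sqrt_mul_sqrt hM.posSemidef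
  have hu : IsUnit (CFC.sqrt (CFC.sqrt Ξ * S * CFC.sqrt Ξ)).det :=
    (Matrix.isUnit_iff_isUnit_det _).1 hR.isUnit
  unfold otMatrix
  set T := CFC.sqrt Ξ
  set R := CFC.sqrt (T * S * T)
  calc T * R⁻¹ * T * S * (T * R⁻¹ * T) = T * (R⁻¹ * (T * S * T) * R⁻¹) * T := by
        simp only [mul_assoc]
    _ = T * T := by
        rw [← h1, ← mul_assoc R⁻¹, Matrix.nonsing_inv_mul _ hu, one_mul,
          Matrix.mul_nonsing_inv _ hu, mul_one]
    _ = Ξ := sqrt_mul_sqrt hΞ.posSemidef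

/-- The inverse map transports back, so both dual potentials contribute the same trace. -/
lemma trace_inv_mul_eq {A : Matrix (Fin d) (Fin d) ℝ} (hA : A.PosDef) (h : A * S * A = Ξ) :
    (A⁻¹ * Ξ).trace = (A * S).trace := by
  have hu : IsUnit A.det := (Matrix.isUnit_iff_isUnit_det _).1 hA.isUnit
  rw [← h, mul_assoc A, ← mul_assoc A⁻¹, Matrix.nonsing_inv_mul _ hu, one_mul,
    Matrix.trace_mul_comm]

/-- Inserting T T⁻¹, with T = Ξ^{1/2}, makes T S T = R² appear and cancels R⁻¹. The right side is
the matrix form of the eigenvalue sum in υ². -/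
lemma trace_otMatrix_mul_mul_self (hΞ : Ξ.PosDef) (hS : S.PosDef) :
    (otMatrix Ξ S * S * S).trace =
      (CFC.sqrt (CFC.sqrt Ξ * S * CFC.sqrt Ξ) * ((CFC.sqrt Ξ)⁻¹ * S * CFC.sqrt Ξ)).trace := by
  have hM := posDef_conj hS (posDef_sqrt hΞ)
  have hR := posDef_sqrt hM
  have h1 := sqrt_mul_sqrt hM.posSemidef
  have hu : IsUnit (CFC.sqrt (CFC.sqrt Ξ * S * CFC.sqrt Ξ)).det :=
    (Matrix.isUnit_iff_isUnit_det _).1 hR.isUnit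
  have hv : IsUnit (CFC.sqrt Ξ).det := (Matrix.isUnit_iff_isUnit_det _).1 (posDef_sqrt hΞ).isUnit
  unfold otMatrix
  set T := CFC.sqrt Ξ
  set R := CFC.sqrt (T * S * T)
  calc (T * R⁻¹ * T * S * S).trace = (R⁻¹ * (T * S * (T * T⁻¹) * S * T)).trace := by
        rw [Matrix.mul_nonsing_inv _ hv, mul_one, mul_assoc T, mul_assoc T, mul_assoc T,
          Matrix.trace_mul_comm]
        simp only [mul_assoc]
    _ = (R⁻¹ * (R * R) * (T⁻¹ * S * T)).trace := by
        rw [h1]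
        simp only [mul_assoc]
    _ = _ := by rw [← mul_assoc R⁻¹, Matrix.nonsing_inv_mul _ hu, one_mul]

/-- Tangents of the concave function `S ↦ 2 tr (Ξ^{1/2} S Ξ^{1/2})^{1/2}`. -/
lemma trace_sub_le_of_mul_mul_eq {A₁ A₂ S₁ S₂ : Matrix (Fin d) (Fin d) ℝ}
    (hA₁ : A₁.IsHermitian) (hA₂ : A₂.PosDef) (hS₁ : S₁.PosSemidef)
    (h₁ : A₁ * S₁ * A₁ = Ξ) (h₂ : A₂ * S₂ * A₂ = Ξ) :
    2 * (A₁ * S₁).trace - 2 * (A₂ * S₂).trace ≤ (A₂ * (S₁ - S₂)).trace := by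
  have hu : IsUnit A₂.det := (Matrix.isUnit_iff_isUnit_det _).1 hA₂.isUnit
  -- The gap in the claimed inequality is exactly tr((A₂ - A₁) A₂⁻¹ (A₂ - A₁) S₁) = tr(A₂ S₁) - 2
  -- tr(A₁ S₁) + tr(A₂ S₂).
  have h3 := trace_mul_nonneg (posSemidef_conj hA₂.inv.posSemidef
    (hA₂.isHermitian.sub hA₁)) hS₁
  have h4 : (A₂ - A₁) * A₂⁻¹ * (A₂ - A₁) = A₂ - A₁ - A₁ + A₁ * A₂⁻¹ * A₁ := by
    rw [sub_mul, Matrix.mul_nonsing_inv _ hu, sub_mul, one_mul, mul_sub, mul_assoc A₁ A₂⁻¹ A₂,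
      Matrix.nonsing_inv_mul _ hu, mul_one]
    abel
  have h5 : (A₁ * A₂⁻¹ * A₁ * S₁).trace = (A₂ * S₂).trace := by
    rw [← trace_inv_mul_eq hA₂ h₂, ← h₁, mul_assoc, mul_assoc, Matrix.trace_mul_comm]
    simp only [mul_assoc]
  rw [h4, add_mul, sub_mul, sub_mul, Matrix.trace_add, Matrix.trace_sub, Matrix.trace_sub, h5] at h3
  rw [mul_sub, Matrix.trace_sub]
  linarith

open scoped Matrix.Norms.L2Operator in
lemma tendsto_sqrt {κ : Type*} {l : Filter κ} {F : κ → Matrix (Fin d) (Fin d) ℝ}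
    (hF : Tendsto F l (𝓝 S)) (hFs : ∀ᶠ k in l, (F k).PosSemidef) (hS : S.PosSemidef) :
    Tendsto (fun k => CFC.sqrt (F k)) l (𝓝 (CFC.sqrt S)) := by
  have h := CFC.continuousOn_sqrt (A := Matrix (Fin d) (Fin d) ℝ) S hS.nonneg
  exact h.tendsto.comp (tendsto_nhdsWithin_iff.2 ⟨hF, hFs.mono fun k hk => hk.nonneg⟩)

/-- Continuity of the supergradient is what upgrades the tangent inequalities to a first order
expansion. -/
lemma tendsto_otMatrix {κ : Type*} {l : Filter κ} {F : κ → Matrix (Fin d) (Fin d) ℝ}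
    (hF : Tendsto F l (𝓝 S)) (hFs : ∀ᶠ k in l, (F k).PosSemidef) (hΞ : Ξ.PosDef)
    (hS : S.PosDef) :
    Tendsto (fun k => otMatrix Ξ (F k)) l (𝓝 (otMatrix Ξ S)) := by
  have hT := posDef_sqrt hΞ
  have hR := posDef_sqrt (posDef_conj hS hT)
  have h1 : Tendsto (fun k => CFC.sqrt (CFC.sqrt Ξ * F k * CFC.sqrt Ξ)) l
      (𝓝 (CFC.sqrt (CFC.sqrt Ξ * S * CFC.sqrt Ξ))) :=
    tendsto_sqrt ((hF.const_mul _).mul_const _)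
      (hFs.mono fun k hk => posSemidef_conj hk hT.isHermitian)
      (posDef_conj hS hT).posSemidef
  have h2 : ContinuousAt (fun A : Matrix (Fin d) (Fin d) ℝ => A⁻¹)
      (CFC.sqrt (CFC.sqrt Ξ * S * CFC.sqrt Ξ)) := by
    simp only [Matrix.inv_def, Ring.inverse_eq_inv']
    have h3 : Continuous fun A : Matrix (Fin d) (Fin d) ℝ => A := continuous_id
    exact (h3.matrix_det.continuousAt.inv₀ hR.det_pos.ne').smul h3.matrix_adjugate.continuousAt
  exact ((h2.tendsto.comp h1).const_mul _).mul_const _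

lemma eventually_posDef {κ : Type*} {l : Filter κ} {F : κ → Matrix (Fin d) (Fin d) ℝ}
    (hF : Tendsto F l (𝓝 S)) (hFs : ∀ᶠ k in l, (F k).PosSemidef) (hS : S.PosDef) :
    ∀ᶠ k in l, (F k).PosDef := by
  have h1 : Tendsto (fun k => (F k).det) l (𝓝 S.det) :=
    ((continuous_id.matrix_det).tendsto S).comp hF
  filter_upwards [h1.eventually_ne hS.det_pos.ne', hFs] with k hk hks
  exact hks.posDef_iff_isUnit.2 ((Matrix.isUnit_iff_isUnit_det _).2 hk.isUnit)

end Matrices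

/-! ### Second moments of Gaussian laws -/

section Gelbrich

variable {d : ℕ}

lemma dotProduct_mulVec_eq_sum (B : Matrix (Fin d) (Fin d) ℝ) (u v : Fin d → ℝ) :
    u ⬝ᵥ B *ᵥ v = ∑ a, ∑ b, B a b * (u a * v b) := by
  simp only [dotProduct, Matrix.mulVec, Finset.mul_sum]
  exact Finset.sum_congr rfl fun a _ => Finset.sum_congr rfl fun b _ => by ring

lemma memLp_coord_sub (P : Measure (EuclideanSpace ℝ (Fin d))) [IsGaussian P] (c : ℝ) (a : Fin d)
    {p : ℝ≥0∞} (hp : p ≠ ∞) : MemLp (fun x => x a - c) p P := by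
  have h := (EuclideanSpace.proj a : EuclideanSpace ℝ (Fin d) →L[ℝ] ℝ).comp_memLp'
    (IsGaussian.memLp_id P p hp)
  exact h.sub (memLp_const c)

lemma integrable_coord_sub (P : Measure (EuclideanSpace ℝ (Fin d))) [IsGaussian P] (c : ℝ)
    (a : Fin d) : Integrable (fun x => x a - c) P :=
  memLp_one_iff_integrable.1 (memLp_coord_sub P c a ENNReal.one_ne_top)

lemma integrable_coord_sub_mul (P : Measure (EuclideanSpace ℝ (Fin d))) [IsGaussian P] (c e : ℝ)
    (a b : Fin d) : Integrable (fun x => (x a - c) * (x b - e)) P :=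
  (memLp_coord_sub P c a (p := 2) ENNReal.ofNat_ne_top).integrable_mul
    (memLp_coord_sub P e b (p := 2) ENNReal.ofNat_ne_top)

lemma integral_coord_sub (m : EuclideanSpace ℝ (Fin d)) (S : Matrix (Fin d) (Fin d) ℝ)
    (a : Fin d) : ∫ x, (x a - m a) ∂(multivariateGaussian m S) = 0 := by
  have h := (EuclideanSpace.proj a : EuclideanSpace ℝ (Fin d) →L[ℝ] ℝ).integral_comp_comm
    (μ := multivariateGaussian m S) IsGaussian.integrable_fun_id
  rw [integral_id_multivariateGaussian] at h
  change ∫ x, x a ∂(multivariateGaussian m S) = m a at h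
  have h0 := integrable_coord_sub (multivariateGaussian m S) 0 a
  simp only [sub_zero] at h0
  rw [integral_sub h0 (integrable_const _), h]
  simp

lemma integral_coord_sub_mul (m : EuclideanSpace ℝ (Fin d)) {S : Matrix (Fin d) (Fin d) ℝ}
    (hS : S.PosSemidef) (a b : Fin d) :
    ∫ x, (x a - m a) * (x b - m b) ∂(multivariateGaussian m S) = S a b := by
  have hm : ∀ a, ∫ x, x a ∂(multivariateGaussian m S) = m a := by
    intro a
    have h := integral_coord_sub m S a
    have h0 := integrable_coord_sub (multivariateGaussian m S) 0 a
    simp only [sub_zero] at h0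
    rw [integral_sub h0 (integrable_const _)] at h
    simpa [sub_eq_zero] using h
  rw [← covariance_eval_multivariateGaussian (μ := m) hS a b, covariance, hm, hm]

lemma integrable_quadratic (P : Measure (EuclideanSpace ℝ (Fin d))) [IsGaussian P]
    (m : EuclideanSpace ℝ (Fin d)) (B : Matrix (Fin d) (Fin d) ℝ) :
    Integrable (fun x => (x - m).ofLp ⬝ᵥ B *ᵥ (x - m).ofLp) P := by
  simp_rw [dotProduct_mulVec_eq_sum, PiLp.sub_apply]
  exact integrable_finsetSum _ fun a _ => integrable_finsetSum _ fun b _ =>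
    (integrable_coord_sub_mul P (m a) (m b) a b).const_mul _

lemma integral_quadratic (m : EuclideanSpace ℝ (Fin d)) (B : Matrix (Fin d) (Fin d) ℝ)
    {S : Matrix (Fin d) (Fin d) ℝ} (hS : S.PosSemidef) :
    ∫ x, (x - m).ofLp ⬝ᵥ B *ᵥ (x - m).ofLp ∂(multivariateGaussian m S) = (B * S).trace := by
  simp_rw [dotProduct_mulVec_eq_sum, PiLp.sub_apply]
  have hint := fun a b => (integrable_coord_sub_mul (multivariateGaussian m S) (m a) (m b) a b)
  refine (integral_finsetSum _ fun a _ => integrable_finsetSum _ fun b _ =>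
    (hint a b).const_mul (B a b)).trans ?_
  simp only [Matrix.trace, Matrix.diag, Matrix.mul_apply]
  refine Finset.sum_congr rfl fun a _ => ?_
  refine (integral_finsetSum _ fun b _ => (hint a b).const_mul (B a b)).trans ?_
  refine Finset.sum_congr rfl fun b _ => ?_
  rw [integral_const_mul]
  congr 1
  refine (integral_coord_sub_mul m hS a b).trans ?_
  simpa using (hS.isHermitian.apply a b).symm

lemma integrable_linear (P : Measure (EuclideanSpace ℝ (Fin d))) [IsGaussian P]
    (m : EuclideanSpace ℝ (Fin d)) (w : Fin d → ℝ) :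
    Integrable (fun x => w ⬝ᵥ (x - m).ofLp) P :=
  integrable_finsetSum _ fun a _ => (integrable_coord_sub P (m a) a).const_mul _

lemma integral_linear (m : EuclideanSpace ℝ (Fin d)) (S : Matrix (Fin d) (Fin d) ℝ)
    (w : Fin d → ℝ) : ∫ x, w ⬝ᵥ (x - m).ofLp ∂(multivariateGaussian m S) = 0 := by
  simp only [dotProduct, PiLp.sub_apply]
  rw [integral_finsetSum _ fun a _ => (integrable_coord_sub _ (m a) a).const_mul _]
  refine Finset.sum_eq_zero fun a _ => ?_
  rw [integral_const_mul]
  exact mul_eq_zero_of_right _ (integral_coord_sub m S a)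

/-! ### The Wasserstein distance of Gaussian laws -/

/-- The dual potential for the transport of Gaussian laws. -/
def gaussianPotential (m w : EuclideanSpace ℝ (Fin d)) (A : Matrix (Fin d) (Fin d) ℝ)
    (x : EuclideanSpace ℝ (Fin d)) : ℝ :=
  (x - m).ofLp ⬝ᵥ (1 - A) *ᵥ (x - m).ofLp + 2 * (w.ofLp ⬝ᵥ (x - m).ofLp)

lemma integrable_gaussianPotential (P : Measure (EuclideanSpace ℝ (Fin d))) [IsGaussian P]
    (m w : EuclideanSpace ℝ (Fin d)) (A : Matrix (Fin d) (Fin d) ℝ) :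
    Integrable (gaussianPotential m w A) P :=
  (integrable_quadratic P m (1 - A)).add ((integrable_linear P m w.ofLp).const_mul 2)

lemma integral_gaussianPotential (m w : EuclideanSpace ℝ (Fin d)) (A : Matrix (Fin d) (Fin d) ℝ)
    {S : Matrix (Fin d) (Fin d) ℝ} (hS : S.PosSemidef) :
    ∫ x, gaussianPotential m w A x ∂(multivariateGaussian m S) = S.trace - (A * S).trace := by
  simp only [gaussianPotential]
  rw [integral_add (integrable_quadratic _ m (1 - A)) ((integrable_linear _ m w.ofLp).const_mul 2),
    integral_quadratic m (1 - A) hS, integral_const_mul, integral_linear, sub_mul, one_mul,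
    Matrix.trace_sub]
  ring

/-- Kantorovich duality made explicit: the cost is a sum of potentials in x and in y plus a
nonnegative defect, which vanishes on the graph y = ν + A (x - m). -/
lemma norm_sub_sq_eq_potential_add {A : Matrix (Fin d) (Fin d) ℝ} (hA : A.PosDef)
    (m ν x y : EuclideanSpace ℝ (Fin d)) :
    ‖x - y‖ ^ 2 = gaussianPotential m (m - ν) A x + gaussianPotential ν (ν - m) A⁻¹ y
      + ‖m - ν‖ ^ 2 + (A *ᵥ (x - m).ofLp - (y - ν).ofLp) ⬝ᵥ
        A⁻¹ *ᵥ (A *ᵥ (x - m).ofLp - (y - ν).ofLp) := by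
  have hu : IsUnit A.det := (Matrix.isUnit_iff_isUnit_det _).1 hA.isUnit
  have hAt : Aᵀ = A := hA.isHermitian.eq
  have hn : ∀ z : EuclideanSpace ℝ (Fin d), ‖z‖ ^ 2 = z.ofLp ⬝ᵥ z.ofLp := by
    intro z
    rw [EuclideanSpace.real_norm_sq_eq]
    simp [dotProduct, sq]
  have hxy : (x - y).ofLp = (x - m).ofLp - (y - ν).ofLp + (m - ν).ofLp := by
    ext a
    simp
    ring
  have hsymm : (ν - m).ofLp = -(m - ν).ofLp := by
    ext a
    simp
  rw [hn, hn, hxy, gaussianPotential, gaussianPotential, hsymm]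
  generalize (x - m).ofLp = u
  generalize (y - ν).ofLp = v
  generalize (m - ν).ofLp = w
  have h1 : (A *ᵥ u) ⬝ᵥ A⁻¹ *ᵥ (A *ᵥ u) = u ⬝ᵥ A *ᵥ u := by
    rw [Matrix.mulVec_mulVec, Matrix.nonsing_inv_mul _ hu, Matrix.one_mulVec, dotProduct_comm]
  have h2 : (A *ᵥ u) ⬝ᵥ A⁻¹ *ᵥ v = u ⬝ᵥ v := by
    rw [dotProduct_comm, Matrix.dotProduct_mulVec, ← Matrix.mulVec_transpose, hAt,
      Matrix.mulVec_mulVec, Matrix.mul_nonsing_inv _ hu, Matrix.one_mulVec, dotProduct_comm]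
  have h3 : v ⬝ᵥ A⁻¹ *ᵥ (A *ᵥ u) = u ⬝ᵥ v := by
    rw [Matrix.mulVec_mulVec, Matrix.nonsing_inv_mul _ hu, Matrix.one_mulVec, dotProduct_comm]
  simp only [Matrix.mulVec_sub, Matrix.sub_mulVec, Matrix.one_mulVec, dotProduct_sub,
    sub_dotProduct, add_dotProduct, dotProduct_add, neg_dotProduct, h1, h2, h3]
  rw [dotProduct_comm u w, dotProduct_comm v w, dotProduct_comm v u]
  ring

/-- Both sides are Gaussian, so comparing means and covariances suffices. -/
lemma map_affine_multivariateGaussian {A S Ξ : Matrix (Fin d) (Fin d) ℝ} (hA : A.IsHermitian)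
    (hS : S.PosSemidef) (hΞ : Ξ.PosSemidef) (h : A * S * A = Ξ) (m ν : EuclideanSpace ℝ (Fin d)) :
    (multivariateGaussian m S).map
      (fun x => (ν - Matrix.toEuclideanCLM (𝕜 := ℝ) A m) + Matrix.toEuclideanCLM (𝕜 := ℝ) A x) =
      multivariateGaussian ν Ξ := by
  have h1 : (multivariateGaussian m S).map
      (fun x => (ν - Matrix.toEuclideanCLM (𝕜 := ℝ) A m) + Matrix.toEuclideanCLM (𝕜 := ℝ) A x) =
      ((multivariateGaussian m S).map (Matrix.toEuclideanCLM (𝕜 := ℝ) A)).map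
        (fun x => (ν - Matrix.toEuclideanCLM (𝕜 := ℝ) A m) + x) := by
    rw [Measure.map_map (measurable_const_add _) (by fun_prop)]
    rfl
  have hg : IsGaussian ((multivariateGaussian m S).map
      (fun x => (ν - Matrix.toEuclideanCLM (𝕜 := ℝ) A m) +
        Matrix.toEuclideanCLM (𝕜 := ℝ) A x)) := by
    rw [h1]
    infer_instance
  refine IsGaussian.ext ?_ ?_
  · simp only [id_eq]
    rw [integral_map (by fun_prop) (by fun_prop), integral_add (integrable_const _)
      ((Matrix.toEuclideanCLM (𝕜 := ℝ) A).integrable_comp IsGaussian.integrable_fun_id),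
      ContinuousLinearMap.integral_comp_comm _ IsGaussian.integrable_fun_id]
    simp
  · ext u v
    have hAt : Aᵀ = A := hA.eq
    rw [h1, covarianceBilin_map_const_add, covarianceBilin_map IsGaussian.memLp_two_id,
      covarianceBilin_multivariateGaussian hS, covarianceBilin_multivariateGaussian hΞ]
    have hadj : ContinuousLinearMap.adjoint (Matrix.toEuclideanCLM (𝕜 := ℝ) A) =
        Matrix.toEuclideanCLM (𝕜 := ℝ) A := by
      rw [← ContinuousLinearMap.star_eq_adjoint, ← map_star, Matrix.star_eq_conjTranspose, hA.eq]
    rw [hadj, Matrix.ofLp_toEuclideanCLM, Matrix.ofLp_toEuclideanCLM, ← h,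
      Matrix.mulVec_mulVec, Matrix.dotProduct_mulVec, Matrix.dotProduct_mulVec,
      mul_assoc, ← Matrix.vecMul_vecMul u.ofLp,
      ← Matrix.mulVec_transpose A u.ofLp, hAt]

lemma ofReal_integral_le_lintegral_ofReal {α : Type*} [MeasurableSpace α] {μ : Measure α}
    {f : α → ℝ} (hf : Integrable f μ) :
    ENNReal.ofReal (∫ z, f z ∂μ) ≤ ∫⁻ z, ENNReal.ofReal (f z) ∂μ := by
  calc ENNReal.ofReal (∫ z, f z ∂μ) ≤ ENNReal.ofReal (∫ z, max (f z) 0 ∂μ) :=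
        ENNReal.ofReal_le_ofReal (integral_mono hf hf.pos_part fun z => le_max_left _ _)
    _ = ∫⁻ z, ENNReal.ofReal (max (f z) 0) ∂μ :=
        ofReal_integral_eq_lintegral_ofReal hf.pos_part (ae_of_all _ fun z => le_max_right _ _)
    _ = ∫⁻ z, ENNReal.ofReal (f z) ∂μ := by simp

lemma enorm_rpow_two_eq {F : Type*} [SeminormedAddCommGroup F] (z : F) :
    ‖z‖ₑ ^ (2 : ℝ) = ENNReal.ofReal (‖z‖ ^ 2) := by
  rw [← ofReal_norm, ENNReal.ofReal_rpow_of_nonneg (norm_nonneg _) zero_le_two,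
    Real.rpow_two]

variable {A S Ξ : Matrix (Fin d) (Fin d) ℝ}

/-- The potentials see only the marginals, so the value is the same for every coupling. -/
lemma integral_potential_coupling (hA : A.PosDef) (hS : S.PosSemidef) (hΞ : Ξ.PosSemidef)
    (h : A * S * A = Ξ) (m ν : EuclideanSpace ℝ (Fin d))
    {π : Measure (EuclideanSpace ℝ (Fin d) × EuclideanSpace ℝ (Fin d))}
    (hπ : IsCoupling π (multivariateGaussian m S) (multivariateGaussian ν Ξ)) :
    Integrable (fun z => gaussianPotential m (m - ν) A z.1 + gaussianPotential ν (ν - m) A⁻¹ z.2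
      + ‖m - ν‖ ^ 2) π ∧
    ∫ z, (gaussianPotential m (m - ν) A z.1 + gaussianPotential ν (ν - m) A⁻¹ z.2
      + ‖m - ν‖ ^ 2) ∂π = ‖m - ν‖ ^ 2 + S.trace + Ξ.trace - 2 * (A * S).trace := by
  have hprob : IsProbabilityMeasure π := by
    refine ⟨?_⟩
    have h1 : (π.map Prod.fst) Set.univ = 1 := by
      rw [hπ.1]
      exact measure_univ
    rwa [Measure.map_apply measurable_fst MeasurableSet.univ, Set.preimage_univ] at h1
  have i1 : Integrable (fun z : EuclideanSpace ℝ (Fin d) × EuclideanSpace ℝ (Fin d) =>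
      gaussianPotential m (m - ν) A z.1) π := by
    have := integrable_gaussianPotential (multivariateGaussian m S) m (m - ν) A
    rw [← hπ.1] at this
    exact this.comp_measurable measurable_fst
  have i2 : Integrable (fun z : EuclideanSpace ℝ (Fin d) × EuclideanSpace ℝ (Fin d) =>
      gaussianPotential ν (ν - m) A⁻¹ z.2) π := by
    have := integrable_gaussianPotential (multivariateGaussian ν Ξ) ν (ν - m) A⁻¹
    rw [← hπ.2] at this
    exact this.comp_measurable measurable_snd
  have e1 : ∫ z, gaussianPotential m (m - ν) A z.1 ∂π = S.trace - (A * S).trace := by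
    have := integral_gaussianPotential m (m - ν) A hS
    have hm := (integrable_gaussianPotential (multivariateGaussian m S) m (m - ν) A).1
    rw [← hπ.1] at this hm
    rwa [integral_map measurable_fst.aemeasurable hm] at this
  have e2 : ∫ z, gaussianPotential ν (ν - m) A⁻¹ z.2 ∂π = Ξ.trace - (A⁻¹ * Ξ).trace := by
    have := integral_gaussianPotential ν (ν - m) A⁻¹ hΞ
    have hm := (integrable_gaussianPotential (multivariateGaussian ν Ξ) ν (ν - m) A⁻¹).1
    rw [← hπ.2] at this hm
    rwa [integral_map measurable_snd.aemeasurable hm] at this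
  have i3 : Integrable (fun z : EuclideanSpace ℝ (Fin d) × EuclideanSpace ℝ (Fin d) =>
      gaussianPotential m (m - ν) A z.1 + gaussianPotential ν (ν - m) A⁻¹ z.2) π := i1.add i2
  refine ⟨i3.add (integrable_const _), ?_⟩
  rw [integral_add i3 (integrable_const _), integral_add i1 i2, e1, e2,
    trace_inv_mul_eq hA h]
  simp
  ring

/-- The Wasserstein distance of nondegenerate Gaussian laws. -/
lemma sqWasserstein_multivariateGaussian (hA : A.PosDef) (hS : S.PosSemidef) (hΞ : Ξ.PosSemidef)
    (h : A * S * A = Ξ) (m ν : EuclideanSpace ℝ (Fin d)) :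
    sqWasserstein (multivariateGaussian m S) (multivariateGaussian ν Ξ) =
      ‖m - ν‖ ^ 2 + S.trace + Ξ.trace - 2 * (A * S).trace := by
  set G := ‖m - ν‖ ^ 2 + S.trace + Ξ.trace - 2 * (A * S).trace with hG
  set T : EuclideanSpace ℝ (Fin d) → EuclideanSpace ℝ (Fin d) := fun x =>
    (ν - Matrix.toEuclideanCLM (𝕜 := ℝ) A m) + Matrix.toEuclideanCLM (𝕜 := ℝ) A x with hT
  have hTm : Measurable T := by fun_prop
  have hc : IsCoupling ((multivariateGaussian m S).map fun x => (x, T x))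
      (multivariateGaussian m S) (multivariateGaussian ν Ξ) := by
    constructor
    · rw [Measure.map_map measurable_fst (by fun_prop)]
      exact Measure.map_id
    · rw [Measure.map_map measurable_snd (by fun_prop)]
      exact map_affine_multivariateGaussian hA.isHermitian hS hΞ h m ν
  obtain ⟨hci, hce⟩ := integral_potential_coupling hA hS hΞ h m ν hc
  -- The defect vanishes on the graph of T, so this coupling attains the dual value G.
  have hcost : ∀ x, ‖x - T x‖ ^ 2 = gaussianPotential m (m - ν) A x +
      gaussianPotential ν (ν - m) A⁻¹ (T x) + ‖m - ν‖ ^ 2 := by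
    intro x
    rw [norm_sub_sq_eq_potential_add hA m ν x (T x)]
    have : A *ᵥ (x - m).ofLp - (T x - ν).ofLp = 0 := by
      simp only [hT, WithLp.ofLp_sub, WithLp.ofLp_add, Matrix.ofLp_toEuclideanCLM,
        Matrix.mulVec_sub]
      abel
    rw [this]
    simp
  have hcost2 : ∫⁻ z, ‖z.1 - z.2‖ₑ ^ (2 : ℝ) ∂((multivariateGaussian m S).map fun x => (x, T x)) =
      ENNReal.ofReal G := by
    simp_rw [enorm_rpow_two_eq]
    rw [lintegral_map (by fun_prop) (by fun_prop), hG, ← hce,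
      integral_map (by fun_prop) hci.1]
    simp_rw [← hcost]
    refine (ofReal_integral_eq_lintegral_ofReal ?_ (ae_of_all _ fun _ => sq_nonneg _)).symm
    simp_rw [hcost]
    exact hci.comp_measurable (f := fun x => (x, T x)) (by fun_prop)
  have hG0 : 0 ≤ G := by
    rw [hG, ← hce, integral_map (by fun_prop) hci.1]
    simp_rw [← hcost]
    exact integral_nonneg fun _ => sq_nonneg _
  have hw : wasserstein 2 (multivariateGaussian m S) (multivariateGaussian ν Ξ) =
      ENNReal.ofReal G ^ (1 / 2 : ℝ) := by
    unfold wasserstein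
    refine le_antisymm ((iInf₂_le ((multivariateGaussian m S).map fun x => (x, T x)) hc).trans_eq
      (congrArg (· ^ (1 / 2 : ℝ)) hcost2)) ?_
    -- For an arbitrary coupling, dropping the nonnegative defect bounds the cost below by G. The
    -- potential sum may be negative at some points, hence the detour through
    -- `ofReal_integral_le_lintegral_ofReal`.
    refine le_iInf₂ fun π hπ => ?_
    obtain ⟨hi, he⟩ := integral_potential_coupling hA hS hΞ h m ν hπ
    refine ENNReal.rpow_le_rpow ?_ (by norm_num)
    rw [hG, ← he]
    refine (ofReal_integral_le_lintegral_ofReal hi).trans (lintegral_mono fun z => ?_)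
    rw [enorm_rpow_two_eq]
    refine ENNReal.ofReal_le_ofReal ?_
    rw [norm_sub_sq_eq_potential_add hA m ν z.1 z.2]
    have := hA.inv.posSemidef.dotProduct_mulVec_nonneg (A *ᵥ (z.1 - m).ofLp - (z.2 - ν).ofLp)
    rw [star_trivial] at this
    linarith
  rw [sqWasserstein, hw, ENNReal.ofReal_rpow_of_nonneg hG0 (by norm_num), ENNReal.toReal_ofReal
    (by positivity), ← Real.sqrt_eq_rpow, Real.sq_sqrt hG0]

end Gelbrich

/-! ### The variance of a quadratic polynomial of a Gaussian vector -/

section Variance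

/-- Iterating p ↦ p' + t p from p = 1 gives the derivatives of the moment generating function exp(t²
/ 2), whose values at 0 are the Gaussian moments. -/
lemma hasDerivAt_mul_exp_sq {p : ℝ → ℝ} {p' t : ℝ} (hp : HasDerivAt p p' t) :
    HasDerivAt (fun t => p t * Real.exp (t ^ 2 / 2)) ((p' + t * p t) * Real.exp (t ^ 2 / 2)) t := by
  have h1 : HasDerivAt (fun t : ℝ => t ^ 2 / 2) t t := by
    have := (hasDerivAt_pow 2 t).div_const 2
    simpa using this
  convert! hp.mul h1.exp using 1
  ring

lemma moments_gaussianReal_zero_one :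
    ∫ z, z ^ 2 ∂(gaussianReal 0 1) = 1 ∧ ∫ z, z ^ 3 ∂(gaussianReal 0 1) = 0 ∧
      ∫ z, z ^ 4 ∂(gaussianReal 0 1) = 3 := by
  have hmem : (0 : ℝ) ∈ interior (integrableExpSet id (gaussianReal 0 1)) := by
    simp [integrableExpSet_id_gaussianReal]
  have h0 : mgf id (gaussianReal 0 1) = fun t => Real.exp (t ^ 2 / 2) := by
    ext t
    rw [mgf_gaussianReal (μ := 0) (v := 1) (by simp)]
    simp
  have h1 : deriv (fun t : ℝ => Real.exp (t ^ 2 / 2)) = fun t => t * Real.exp (t ^ 2 / 2) := by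
    ext t
    have := (hasDerivAt_mul_exp_sq (hasDerivAt_const t (1 : ℝ))).deriv
    simpa using this
  have h2 : deriv (fun t : ℝ => t * Real.exp (t ^ 2 / 2)) =
      fun t => (1 + t ^ 2) * Real.exp (t ^ 2 / 2) := by
    ext t
    rw [(hasDerivAt_mul_exp_sq (hasDerivAt_id' t)).deriv, sq]
  have h3 : deriv (fun t : ℝ => (1 + t ^ 2) * Real.exp (t ^ 2 / 2)) =
      fun t => (3 * t + t ^ 3) * Real.exp (t ^ 2 / 2) := by
    ext t
    rw [(hasDerivAt_mul_exp_sq ((hasDerivAt_pow 2 t).const_add 1)).deriv]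
    simp
    ring
  have h4 : deriv (fun t : ℝ => (3 * t + t ^ 3) * Real.exp (t ^ 2 / 2)) =
      fun t => (3 + 6 * t ^ 2 + t ^ 4) * Real.exp (t ^ 2 / 2) := by
    ext t
    have h5 : HasDerivAt (fun t : ℝ => 3 * t + t ^ 3) (3 * 1 + 3 * t ^ 2) t := by
      simpa using ((hasDerivAt_id' t).const_mul 3).fun_add (hasDerivAt_pow 3 t)
    rw [(hasDerivAt_mul_exp_sq h5).deriv]
    simp
    ring
  have hm := fun n => iteratedDeriv_mgf_zero hmem n
  simp only [h0, iteratedDeriv_eq_iterate] at hm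
  refine ⟨?_, ?_, ?_⟩
  · have := hm 2
    simpa [h1, h2] using this.symm
  · have := hm 3
    simpa [h1, h2, h3] using this.symm
  · have := hm 4
    simpa [h1, h2, h3, h4] using this.symm

lemma integrable_pow_gaussianReal (k : ℕ) :
    Integrable (fun z : ℝ => z ^ k) (gaussianReal 0 1) := by
  rcases eq_or_ne k 0 with rfl | hk
  · simp
  have h := (memLp_id_gaussianReal (μ := 0) (v := 1) (k : ℝ≥0)).integrable_norm_pow
    (p := k) hk
  exact h.mono' (by fun_prop) (ae_of_all _ fun z => by simp)

lemma memLp_pow_gaussianReal (k : ℕ) : MemLp (fun z : ℝ => z ^ k) 2 (gaussianReal 0 1) := by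
  rw [memLp_two_iff_integrable_sq (by fun_prop)]
  simp_rw [← pow_mul]
  exact integrable_pow_gaussianReal _

lemma variance_quadratic_gaussianReal (a b : ℝ) :
    Var[fun z => a * z ^ 2 + b * z; gaussianReal 0 1] = 2 * a ^ 2 + b ^ 2 := by
  obtain ⟨m2, m3, m4⟩ := moments_gaussianReal_zero_one
  have hi := integrable_pow_gaussianReal
  have m1 : ∫ z, z ∂(gaussianReal 0 1) = 0 := by simp
  have hi1 : Integrable (fun z : ℝ => z) (gaussianReal 0 1) := by simpa using hi 1
  rw [variance_eq_sub]
  · have e1 : ∫ z, (a * z ^ 2 + b * z) ∂(gaussianReal 0 1) = a := by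
      rw [integral_add ((hi 2).const_mul a) (hi1.const_mul b), integral_const_mul,
        integral_const_mul, m1, m2]
      ring
    have e2 : ∫ z, (a * z ^ 2 + b * z) ^ 2 ∂(gaussianReal 0 1) = 3 * a ^ 2 + b ^ 2 := by
      have : ∀ z : ℝ, (a * z ^ 2 + b * z) ^ 2 =
          a ^ 2 * z ^ 4 + (2 * a * b) * z ^ 3 + b ^ 2 * z ^ 2 := fun z => by ring
      simp_rw [this]
      have i1 : Integrable (fun z : ℝ => a ^ 2 * z ^ 4 + (2 * a * b) * z ^ 3)
          (gaussianReal 0 1) := ((hi 4).const_mul (a ^ 2)).add ((hi 3).const_mul (2 * a * b))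
      rw [integral_add i1 ((hi 2).const_mul _), integral_add ((hi 4).const_mul _)
        ((hi 3).const_mul _), integral_const_mul, integral_const_mul, integral_const_mul, m2, m3, m4]
      ring
    simp only [Pi.pow_apply]
    rw [e1, e2]
    ring
  · exact ((memLp_pow_gaussianReal 2).const_mul a).add
      ((by simpa using memLp_pow_gaussianReal 1 : MemLp (fun z : ℝ => z) 2 _).const_mul b)

variable {d : ℕ}

lemma inner_eq_dotProduct (x y : EuclideanSpace ℝ (Fin d)) : inner ℝ x y = x.ofLp ⬝ᵥ y.ofLp := by
  simp [PiLp.inner_apply, dotProduct, mul_comm]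

lemma trace_eq_sum_orthonormalBasis (M : Matrix (Fin d) (Fin d) ℝ)
    (r : OrthonormalBasis (Fin d) ℝ (EuclideanSpace ℝ (Fin d))) :
    M.trace = ∑ k, (r k).ofLp ⬝ᵥ M *ᵥ (r k).ofLp := by
  have h1 : LinearMap.trace ℝ _ (Matrix.toEuclideanLin M) = M.trace := by
    rw [Matrix.toEuclideanLin_eq_toLin_orthonormal, Matrix.trace_toLin_eq]
  rw [← h1, LinearMap.trace_eq_sum_inner _ r]
  simp_rw [inner_eq_dotProduct]
  rfl

/-- In an eigenbasis of C the coordinates remain independent standard normals and the polynomial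
splits into a sum over them, so one-dimensional variances add. -/
lemma variance_quadratic_stdGaussian {C : Matrix (Fin d) (Fin d) ℝ} (hC : C.IsHermitian)
    (b : EuclideanSpace ℝ (Fin d)) :
    Var[fun z => b.ofLp ⬝ᵥ z.ofLp + z.ofLp ⬝ᵥ C *ᵥ z.ofLp;
      stdGaussian (EuclideanSpace ℝ (Fin d))] = b.ofLp ⬝ᵥ b.ofLp + 2 * (C * C).trace := by
  set e := hC.eigenvectorBasis with he
  have hval : ∀ x : Fin d → ℝ, b.ofLp ⬝ᵥ (∑ i, x i • e i).ofLp +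
      (∑ i, x i • e i).ofLp ⬝ᵥ C *ᵥ (∑ i, x i • e i).ofLp =
      ∑ i, (hC.eigenvalues i * x i ^ 2 + inner ℝ b (e i) * x i) := by
    intro x
    have h1 : C *ᵥ (∑ i, x i • e i).ofLp = (∑ i, (x i * hC.eigenvalues i) • e i).ofLp := by
      simp only [WithLp.ofLp_sum, WithLp.ofLp_smul, Matrix.mulVec_sum, Matrix.mulVec_smul]
      refine Finset.sum_congr rfl fun i _ => ?_
      rw [hC.mulVec_eigenvectorBasis, smul_smul]
    rw [h1, ← inner_eq_dotProduct, ← inner_eq_dotProduct, inner_sum,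
      e.orthonormal.inner_sum, ← Finset.sum_add_distrib]
    refine Finset.sum_congr rfl fun i _ => ?_
    rw [inner_smul_right]
    simp
    ring
  have htr : (C * C).trace = ∑ i, hC.eigenvalues i ^ 2 := by
    rw [trace_eq_sum_orthonormalBasis _ e]
    refine Finset.sum_congr rfl fun i _ => ?_
    rw [← Matrix.mulVec_mulVec, hC.mulVec_eigenvectorBasis, Matrix.mulVec_smul,
      hC.mulVec_eigenvectorBasis, dotProduct_smul, dotProduct_smul, ← inner_eq_dotProduct,
      real_inner_self_eq_norm_sq, e.norm_eq_one]
    simp [sq]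
  rw [stdGaussian_eq_map_pi_orthonormalBasis e, variance_map]
  · have h2 : ((fun z : EuclideanSpace ℝ (Fin d) => b.ofLp ⬝ᵥ z.ofLp + z.ofLp ⬝ᵥ C *ᵥ z.ofLp) ∘
        fun x : Fin d → ℝ => ∑ i, x i • e i) =
        ∑ i, fun x : Fin d → ℝ => (fun z => hC.eigenvalues i * z ^ 2 + inner ℝ b (e i) * z) (x i) := by
      ext x
      simp only [Function.comp_apply, hval, Finset.sum_apply]
    rw [h2, variance_sum_pi (X := fun i z => hC.eigenvalues i * z ^ 2 + inner ℝ b (e i) * z)]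
    · simp_rw [variance_quadratic_gaussianReal]
      rw [Finset.sum_add_distrib, ← Finset.mul_sum, htr, e.sum_sq_inner_left,
        ← inner_eq_dotProduct, real_inner_self_eq_norm_sq]
      ring
    · exact fun i => ((memLp_pow_gaussianReal 2).const_mul _).add
        ((by simpa using memLp_pow_gaussianReal 1 : MemLp (fun z : ℝ => z) 2 _).const_mul _)
  · simp_rw [dotProduct_mulVec_eq_sum, dotProduct]
    fun_prop
  · exact Measurable.aemeasurable (by fun_prop)

/-- Substituting x = m + S^{1/2} z reduces to the standard case with C = S^{1/2} B S^{1/2} and b = 2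
S^{1/2} w. -/
lemma variance_quadratic_multivariateGaussian {S B : Matrix (Fin d) (Fin d) ℝ}
    (hS : S.PosSemidef) (hB : B.IsHermitian) (m w : EuclideanSpace ℝ (Fin d)) :
    Var[fun x => 2 * (w.ofLp ⬝ᵥ (x - m).ofLp) + (x - m).ofLp ⬝ᵥ B *ᵥ (x - m).ofLp;
      multivariateGaussian m S] =
      4 * (w.ofLp ⬝ᵥ S *ᵥ w.ofLp) + 2 * (B * S * B * S).trace := by
  have hR : (CFC.sqrt S)ᵀ = CFC.sqrt S :=
    (Matrix.nonneg_iff_posSemidef.1 (CFC.sqrt_nonneg S)).isHermitian.eq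
  have hC : (CFC.sqrt S * B * CFC.sqrt S).IsHermitian := by
    rw [Matrix.IsHermitian, Matrix.conjTranspose_eq_transpose_of_trivial, Matrix.transpose_mul,
      Matrix.transpose_mul, hR, (show Bᵀ = B from hB.eq), mul_assoc]
  have hsq := sqrt_mul_sqrt hS
  have h := variance_quadratic_stdGaussian hC (WithLp.toLp 2 ((2 : ℝ) • CFC.sqrt S *ᵥ w.ofLp))
  rw [multivariateGaussian, variance_map]
  · convert h using 2
    · ext z
      simp only [Function.comp_apply, add_sub_cancel_left, Matrix.ofLp_toEuclideanCLM]
      rw [smul_dotProduct, smul_eq_mul, dotProduct_comm (CFC.sqrt S *ᵥ w.ofLp),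
        Matrix.dotProduct_mulVec, Matrix.dotProduct_mulVec, ← Matrix.mulVec_transpose, hR,
        dotProduct_comm]
      congr 1
      rw [← Matrix.dotProduct_mulVec, ← Matrix.mulVec_mulVec, ← Matrix.mulVec_mulVec,
        Matrix.dotProduct_mulVec z.ofLp (CFC.sqrt S), ← Matrix.mulVec_transpose, hR]
    · rw [smul_dotProduct, dotProduct_smul, smul_eq_mul, smul_eq_mul, dotProduct_comm,
        Matrix.dotProduct_mulVec, ← Matrix.mulVec_transpose, hR, Matrix.mulVec_mulVec, hsq,
        dotProduct_comm]
      ring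
    · congr 1
      calc (B * S * B * S).trace
          = (B * (CFC.sqrt S * CFC.sqrt S) * B * CFC.sqrt S * CFC.sqrt S).trace := by
            rw [hsq, mul_assoc (B * S * B), hsq]
        _ = _ := by
            rw [Matrix.trace_mul_comm]
            simp only [mul_assoc]
  · simp_rw [dotProduct_mulVec_eq_sum, dotProduct]
    fun_prop
  · fun_prop

/-- From (√M + √c) (√M v - √c v) = M v - c v = 0 and injectivity of the positive definite first
factor. -/
lemma sqrt_mulVec_of_eigenvector {M : Matrix (Fin d) (Fin d) ℝ} (hM : M.PosDef) {v : Fin d → ℝ}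
    (hv : v ≠ 0) {c : ℝ} (h : M *ᵥ v = c • v) : CFC.sqrt M *ᵥ v = √c • v := by
  have hc : 0 < c := by
    have h1 := hM.dotProduct_mulVec_pos hv
    rw [h, dotProduct_smul, star_trivial, smul_eq_mul] at h1
    exact pos_of_mul_pos_left h1 (by simpa using dotProduct_star_self_nonneg v)
  have hR := posDef_sqrt hM
  have hpos : (CFC.sqrt M + √c • (1 : Matrix (Fin d) (Fin d) ℝ)).PosDef :=
    hR.add_posSemidef (Matrix.PosSemidef.one.smul (Real.sqrt_nonneg c))
  have hz : (CFC.sqrt M + √c • (1 : Matrix (Fin d) (Fin d) ℝ)) *ᵥ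
      (CFC.sqrt M *ᵥ v - √c • v) = 0 := by
    rw [Matrix.mulVec_sub, Matrix.add_mulVec, Matrix.add_mulVec, Matrix.mulVec_mulVec,
      sqrt_mul_sqrt hM.posSemidef, h]
    simp only [Matrix.smul_mulVec, Matrix.one_mulVec, Matrix.mulVec_smul, smul_smul,
      Real.mul_self_sqrt hc.le]
    abel
  have := Matrix.mulVec_injective_of_isUnit hpos.isUnit (hz.trans (Matrix.mulVec_zero _).symm)
  exact sub_eq_zero.1 this

/-- The eigenvalue sum is a trace computed in the basis r, equal to tr(A S S). Expanding the right
side and using A S A = Ξ gives 2 tr(S²) - 4 tr(A S S) + 2 tr(Ξ S). -/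
lemma asymptoticVariance_eq {S Ξ : Matrix (Fin d) (Fin d) ℝ} (hS : S.PosDef) (hΞ : Ξ.PosDef)
    (μ ν : EuclideanSpace ℝ (Fin d)) (κ : Fin d → ℝ)
    (r : OrthonormalBasis (Fin d) ℝ (EuclideanSpace ℝ (Fin d)))
    (hκr : IsEigendecomposition (CFC.sqrt Ξ * S * CFC.sqrt Ξ) κ r) :
    asymptoticVariance μ ν S Ξ κ r =
      4 * ((μ - ν).ofLp ⬝ᵥ S *ᵥ (μ - ν).ofLp) +
        2 * ((1 - otMatrix Ξ S) * S * (1 - otMatrix Ξ S) * S).trace := by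
  have hM := posDef_conj hS (posDef_sqrt hΞ)
  have hR : (CFC.sqrt (CFC.sqrt Ξ * S * CFC.sqrt Ξ))ᵀ = CFC.sqrt (CFC.sqrt Ξ * S * CFC.sqrt Ξ) :=
    (posDef_sqrt hM).isHermitian.eq
  have h1 : ∑ k, √(κ k) *
        ((r k).ofLp ⬝ᵥ ((CFC.sqrt Ξ)⁻¹ * S * CFC.sqrt Ξ) *ᵥ (r k).ofLp) =
      (otMatrix Ξ S * S * S).trace := by
    rw [trace_otMatrix_mul_mul_self hΞ hS, trace_eq_sum_orthonormalBasis _ r]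
    refine Finset.sum_congr rfl fun k _ => ?_
    have hrk : (r k).ofLp ≠ 0 := by
      intro h0
      have h2 := r.norm_eq_one k
      rw [show r k = 0 from by ext a; exact congrFun h0 a] at h2
      simp at h2
    rw [← Matrix.mulVec_mulVec _ (CFC.sqrt (CFC.sqrt Ξ * S * CFC.sqrt Ξ)),
      Matrix.dotProduct_mulVec _ (CFC.sqrt (CFC.sqrt Ξ * S * CFC.sqrt Ξ)),
      ← Matrix.mulVec_transpose, hR, sqrt_mulVec_of_eigenvector hM hrk (hκr k), smul_dotProduct,
      smul_eq_mul]
  have h2 : (1 - otMatrix Ξ S) * S * (1 - otMatrix Ξ S) * S =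
      S * S - S * otMatrix Ξ S * S - otMatrix Ξ S * S * S +
        otMatrix Ξ S * S * otMatrix Ξ S * S := by
    noncomm_ring
  have h3 : (S * otMatrix Ξ S * S).trace = (otMatrix Ξ S * S * S).trace := by
    rw [mul_assoc, Matrix.trace_mul_comm]
  have h4 : (ν - μ).ofLp = -(μ - ν).ofLp := by
    ext a
    simp
  rw [asymptoticVariance, h1, h2, Matrix.trace_add, Matrix.trace_sub, Matrix.trace_sub, h3,
    otMatrix_mul_mul_otMatrix hΞ hS, sq S, Matrix.trace_mul_comm S Ξ, h4, Matrix.mulVec_neg,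
    neg_dotProduct_neg]
  ring

end Variance

/-! ### Sample moments -/

section Sample

variable {d : ℕ}

/-- The centered coordinate function `x ↦ x_a - μ_a`. -/
def centeredCoord (μ : EuclideanSpace ℝ (Fin d)) (a : Fin d) (x : EuclideanSpace ℝ (Fin d)) : ℝ :=
  x a - μ a

/-- The product of two centered coordinates. -/
def centeredProd (μ : EuclideanSpace ℝ (Fin d)) (a b : Fin d) (x : EuclideanSpace ℝ (Fin d)) : ℝ :=
  centeredCoord μ a x * centeredCoord μ b x

lemma sampleMean_apply {n : ℕ} (x : Fin n → EuclideanSpace ℝ (Fin d)) (a : Fin d) :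
    sampleMean x a = mean fun i => x i a := by
  simp [sampleMean, mean]

lemma sampleMean_sub_apply {n : ℕ} (hn : n ≠ 0) (μ : EuclideanSpace ℝ (Fin d))
    (x : Fin n → EuclideanSpace ℝ (Fin d)) (a : Fin d) :
    sampleMean x a - μ a = mean fun i => centeredCoord μ a (x i) := by
  simp only [centeredCoord]
  rw [sampleMean_apply, mean_sub, mean_const hn]

/-- Centering at the fixed μ leaves only sample means of fixed functions. At n = 1 both sides are 0,
as the inverse of 0 is 0. -/
lemma sampleCov_apply {n : ℕ} (hn : n ≠ 0) (μ : EuclideanSpace ℝ (Fin d))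
    (x : Fin n → EuclideanSpace ℝ (Fin d)) (a b : Fin d) :
    sampleCov x a b = ((n : ℝ) - 1)⁻¹ * n * ((mean fun i => centeredProd μ a b (x i)) -
      (mean fun i => centeredCoord μ a (x i)) * mean fun i => centeredCoord μ b (x i)) := by
  have hn0 : (n : ℝ) ≠ 0 := by exact_mod_cast hn
  have h1 : ∀ f : Fin n → ℝ, ∑ i, f i = n * mean f := fun f => by
    rw [mean, mul_inv_cancel_left₀ hn0]
  set ca := mean fun i => centeredCoord μ a (x i) with hca
  set cb := mean fun i => centeredCoord μ b (x i) with hcb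
  have h2 : ∀ i, (x i a - sampleMean x a) * (x i b - sampleMean x b) =
      centeredProd μ a b (x i) - cb * centeredCoord μ a (x i) - ca * centeredCoord μ b (x i)
        + ca * cb := by
    intro i
    have ha := sampleMean_sub_apply hn μ x a
    have hb := sampleMean_sub_apply hn μ x b
    rw [← hca] at ha
    rw [← hcb] at hb
    rw [show sampleMean x a = μ a + ca by linarith, show sampleMean x b = μ b + cb by linarith]
    simp only [centeredProd, centeredCoord]
    ring
  simp only [sampleCov, Matrix.of_apply]
  simp_rw [h2]
  rw [h1, mean_add, mean_sub, mean_sub, mean_const_mul, mean_const_mul, mean_const hn, ← hca, ← hcb]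
  ring

lemma posSemidef_sampleCov {n : ℕ} (hn : n ≠ 0) (x : Fin n → EuclideanSpace ℝ (Fin d)) :
    (sampleCov x).PosSemidef := by
  have hn1 : (0 : ℝ) ≤ ((n : ℝ) - 1)⁻¹ := by
    rw [inv_nonneg, sub_nonneg]
    exact_mod_cast Nat.one_le_iff_ne_zero.2 hn
  have h : sampleCov x = ((n : ℝ) - 1)⁻¹ • ∑ i, Matrix.vecMulVec
      (x i - sampleMean x).ofLp (star (x i - sampleMean x).ofLp) := by
    ext a b
    simp [sampleCov, Matrix.sum_apply, Matrix.vecMulVec_apply]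
  rw [h]
  exact (Matrix.posSemidef_sum _ fun i _ => Matrix.posSemidef_vecMulVec_self_star _).smul hn1

/-- The first order expansion of the squared Wasserstein distance of Gaussian laws. -/
lemma abs_sqWasserstein_sub_sub_le {Ξ S₁ S₂ : Matrix (Fin d) (Fin d) ℝ} (hΞ : Ξ.PosDef)
    (hS₁ : S₁.PosDef) (hS₂ : S₂.PosDef) (A₀ : Matrix (Fin d) (Fin d) ℝ)
    (μ ν m₁ m₂ : EuclideanSpace ℝ (Fin d)) :
    |sqWasserstein (multivariateGaussian m₁ S₁) (multivariateGaussian ν Ξ) -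
      sqWasserstein (multivariateGaussian m₂ S₂) (multivariateGaussian ν Ξ) -
      (∑ a, 2 * (μ a - ν a) * (m₁ a - m₂ a) + ((1 - A₀) * (S₁ - S₂)).trace)| ≤
    |∑ a, (m₁ a - m₂ a) * ((m₁ a - μ a) + (m₂ a - μ a))| +
      (|((otMatrix Ξ S₁ - A₀) * (S₁ - S₂)).trace| + |((otMatrix Ξ S₂ - A₀) * (S₁ - S₂)).trace|) := by
  have p1 := posDef_otMatrix hΞ hS₁
  have p2 := posDef_otMatrix hΞ hS₂
  have e1 := otMatrix_mul_mul_otMatrix hΞ hS₁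
  have e2 := otMatrix_mul_mul_otMatrix hΞ hS₂
  rw [sqWasserstein_multivariateGaussian p1 hS₁.posSemidef hΞ.posSemidef e1,
    sqWasserstein_multivariateGaussian p2 hS₂.posSemidef hΞ.posSemidef e2]
  -- The tangents at S₂ and at S₁ bound the increment of the trace term from above and below. The
  -- remainder is then controlled by the distances of the two slopes from A₀.
  have i1 := trace_sub_le_of_mul_mul_eq p1.isHermitian p2 hS₁.posSemidef e1 e2
  have i2 := trace_sub_le_of_mul_mul_eq p2.isHermitian p1 hS₂.posSemidef e2 e1
  have hm : ‖m₁ - ν‖ ^ 2 - ‖m₂ - ν‖ ^ 2 = ∑ a, 2 * (μ a - ν a) * (m₁ a - m₂ a) +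
      ∑ a, (m₁ a - m₂ a) * ((m₁ a - μ a) + (m₂ a - μ a)) := by
    rw [EuclideanSpace.real_norm_sq_eq, EuclideanSpace.real_norm_sq_eq, ← Finset.sum_sub_distrib,
      ← Finset.sum_add_distrib]
    refine Finset.sum_congr rfl fun a _ => ?_
    simp only [PiLp.sub_apply]
    ring
  set s := ∑ a, (m₁ a - m₂ a) * ((m₁ a - μ a) + (m₂ a - μ a))
  set w := ∑ a, 2 * (μ a - ν a) * (m₁ a - m₂ a)
  have e3 : ((1 - A₀) * (S₁ - S₂)).trace =
      S₁.trace - S₂.trace - (A₀ * (S₁ - S₂)).trace := by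
    rw [sub_mul, one_mul, Matrix.trace_sub, Matrix.trace_sub]
  have e4 : ∀ A : Matrix (Fin d) (Fin d) ℝ, ((A - A₀) * (S₁ - S₂)).trace =
      (A * S₁).trace - (A * S₂).trace - (A₀ * (S₁ - S₂)).trace := fun A => by
    rw [sub_mul, Matrix.trace_sub, mul_sub A, Matrix.trace_sub]
  rw [mul_sub, Matrix.trace_sub] at i1 i2
  rw [e3, e4, e4]
  set t₁ := (otMatrix Ξ S₁ * S₁).trace - (otMatrix Ξ S₁ * S₂).trace - (A₀ * (S₁ - S₂)).trace
    with ht₁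
  set t₂ := (otMatrix Ξ S₂ * S₁).trace - (otMatrix Ξ S₂ * S₂).trace - (A₀ * (S₁ - S₂)).trace
    with ht₂
  have hs1 := le_abs_self s
  have hs2 := neg_abs_le s
  have h11 := le_abs_self t₁
  have h12 := neg_abs_le t₁
  have h21 := le_abs_self t₂
  have h22 := neg_abs_le t₂
  rw [abs_le]
  constructor <;> linarith

end Sample

/-! ### The bootstrap along a sequence of samples -/

section Bootstrap

variable {d : ℕ} {n : ℕ → ℕ}

/-- The scaled deviation of the mean of `h` over the resampled data. -/
def bootDev (x : ∀ k, Fin (n k) → EuclideanSpace ℝ (Fin d)) (h : EuclideanSpace ℝ (Fin d) → ℝ)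
    (z : Σ k, (Fin (n k) → Fin (n k))) : ℝ :=
  √(n z.1 : ℝ) * ((mean fun j => h (x z.1 (z.2 j))) - mean fun i => h (x z.1 i))

variable {x : ∀ k, Fin (n k) → EuclideanSpace ℝ (Fin d)} {h : EuclideanSpace ℝ (Fin d) → ℝ}

local notation "J" => inProbability (fun k => resampling (n k)) atTop

lemma sqBounded_bootDev (hn : Tendsto n atTop atTop) {m : ℝ}
    (h2 : Tendsto (fun k => mean fun i => h (x k i) ^ 2) atTop (𝓝 m)) :
    SqBounded (fun k => resampling (n k)) atTop (bootDev x h) := by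
  refine ⟨m + 1, ?_⟩
  filter_upwards [hn.eventually_ne_atTop 0, h2.eventually_le_const (lt_add_one m)] with k hk hm
  exact (lintegral_resampling_sq_le hk fun i => h (x k i)).trans (ENNReal.ofReal_le_ofReal hm)

lemma tendsto_mul_bootDev (hn : Tendsto n atTop atTop) {m : ℝ}
    (h2 : Tendsto (fun k => mean fun i => h (x k i) ^ 2) atTop (𝓝 m))
    {U : (Σ k, (Fin (n k) → Fin (n k))) → ℝ} (hU : Tendsto U J (𝓝 0)) :
    Tendsto (fun z => U z * bootDev x h z) J (𝓝 0) :=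
  (sqBounded_bootDev hn h2).mul_tendsto_zero (fun _ => Measurable.of_discrete) hU

/-- The resampled mean differs from the sample mean by n^{-1/2} times a deviation with bounded
second moments. -/
lemma tendsto_mean_resampled (hn : Tendsto n atTop atTop) {c m : ℝ}
    (h1 : Tendsto (fun k => mean fun i => h (x k i)) atTop (𝓝 c))
    (h2 : Tendsto (fun k => mean fun i => h (x k i) ^ 2) atTop (𝓝 m)) :
    Tendsto (fun z : Σ k, (Fin (n k) → Fin (n k)) => mean fun j => h (x z.1 (z.2 j))) J (𝓝 c) := by
  have hs : Tendsto (fun k => (√(n k : ℝ))⁻¹) atTop (𝓝 0) :=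
    tendsto_inv_atTop_zero.comp (Real.tendsto_sqrt_atTop.comp (tendsto_natCast_atTop_atTop.comp hn))
  have h3 := (tendsto_mul_bootDev hn h2 (hs.comp tendsto_fst_inProbability)).add
    (h1.comp tendsto_fst_inProbability)
  rw [zero_add] at h3
  refine h3.congr' ?_
  filter_upwards [tendsto_fst_inProbability.eventually (hn.eventually_ne_atTop 0)] with z hz
  have : √(n z.1 : ℝ) ≠ 0 := by positivity
  simp only [bootDev, Function.comp_apply]
  rw [inv_mul_cancel_left₀ this]
  ring

end Bootstrap

/-! ### Linearization of the bootstrapped estimator and its limit for deterministic arrays of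
samples -/

section BootstrapLimit

variable {d : ℕ}

/-- The linearization of the Gaussian Wasserstein estimator, as a function of one observation. -/
def influence (μ ν : EuclideanSpace ℝ (Fin d)) (B : Matrix (Fin d) (Fin d) ℝ)
    (x : EuclideanSpace ℝ (Fin d)) : ℝ :=
  2 * ((μ - ν).ofLp ⬝ᵥ (x - μ).ofLp) + (x - μ).ofLp ⬝ᵥ B *ᵥ (x - μ).ofLp

lemma influence_eq_sum (μ ν : EuclideanSpace ℝ (Fin d)) (B : Matrix (Fin d) (Fin d) ℝ)
    (x : EuclideanSpace ℝ (Fin d)) :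
    influence μ ν B x = ∑ a, 2 * (μ a - ν a) * centeredCoord μ a x +
      ∑ a, ∑ b, B a b * centeredProd μ a b x := by
  rw [influence, dotProduct_mulVec_eq_sum, dotProduct, Finset.mul_sum]
  simp only [centeredProd, centeredCoord, PiLp.sub_apply, mul_assoc]

lemma mean_influence {n : ℕ} (μ ν : EuclideanSpace ℝ (Fin d)) (B : Matrix (Fin d) (Fin d) ℝ)
    (x : Fin n → EuclideanSpace ℝ (Fin d)) :
    (mean fun i => influence μ ν B (x i)) =
      ∑ a, 2 * (μ a - ν a) * (mean fun i => centeredCoord μ a (x i)) +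
      ∑ a, ∑ b, B a b * mean fun i => centeredProd μ a b (x i) := by
  simp_rw [influence_eq_sum]
  rw [mean_add, mean_sum, mean_sum]
  simp_rw [mean_sum, mean_const_mul]

/-- The sample sizes tend to infinity, and the first, second and fourth centered sample moments
converge, with limits `0` and `S` for the first two. -/
structure MomentsConverge (μ : EuclideanSpace ℝ (Fin d)) (S : Matrix (Fin d) (Fin d) ℝ)
    (n : ℕ → ℕ) (x : ∀ k, Fin (n k) → EuclideanSpace ℝ (Fin d)) : Prop where
  size : Tendsto n atTop atTop
  coord : ∀ a, Tendsto (fun k => mean fun i => centeredCoord μ a (x k i)) atTop (𝓝 0)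
  prod : ∀ a b, Tendsto (fun k => mean fun i => centeredProd μ a b (x k i)) atTop (𝓝 (S a b))
  prodSq : ∀ a b, ∃ m, Tendsto (fun k => mean fun i => centeredProd μ a b (x k i) ^ 2) atTop (𝓝 m)

variable {μ : EuclideanSpace ℝ (Fin d)} {S : Matrix (Fin d) (Fin d) ℝ}
  {n : ℕ → ℕ} {x : ∀ k, Fin (n k) → EuclideanSpace ℝ (Fin d)}

lemma tendsto_size_ratio (hn : Tendsto n atTop atTop) :
    Tendsto (fun k => ((n k : ℝ) - 1)⁻¹ * n k) atTop (𝓝 1) := by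
  have h0 : Tendsto (fun k => (n k : ℝ)) atTop atTop := tendsto_natCast_atTop_atTop.comp hn
  have h1 : Tendsto (fun k => ((n k : ℝ) - 1)⁻¹) atTop (𝓝 0) :=
    tendsto_inv_atTop_zero.comp (tendsto_atTop_add_const_right _ (-1) h0)
  have h2 := h1.const_add 1
  rw [add_zero] at h2
  refine h2.congr' ?_
  filter_upwards [h0.eventually_gt_atTop 1] with k hk
  have : (n k : ℝ) - 1 ≠ 0 := by linarith
  field_simp
  ring

namespace MomentsConverge

variable (H : MomentsConverge μ S n x)

include H

local notation "J" => inProbability (fun k => resampling (n k)) atTop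

lemma coordSq (a : Fin d) :
    Tendsto (fun k => mean fun i => centeredCoord μ a (x k i) ^ 2) atTop (𝓝 (S a a)) := by
  simpa only [centeredProd, sq] using H.prod a a

lemma coord_resampled (a : Fin d) : Tendsto (fun z : Σ k, (Fin (n k) → Fin (n k)) =>
    mean fun j => centeredCoord μ a (x z.1 (z.2 j))) J (𝓝 0) :=
  tendsto_mean_resampled H.size (H.coord a) (H.coordSq a)

lemma prod_resampled (a b : Fin d) : Tendsto (fun z : Σ k, (Fin (n k) → Fin (n k)) =>
    mean fun j => centeredProd μ a b (x z.1 (z.2 j))) J (𝓝 (S a b)) :=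
  tendsto_mean_resampled H.size (H.prod a b) (H.prodSq a b).choose_spec

lemma eventually_size_ne_zero :
    ∀ᶠ z : Σ k, (Fin (n k) → Fin (n k)) in J, n z.1 ≠ 0 :=
  tendsto_fst_inProbability.eventually (H.size.eventually_ne_atTop 0)

lemma sampleCov_tendsto : Tendsto (fun k => sampleCov (x k)) atTop (𝓝 S) := by
  refine tendsto_pi_nhds.2 fun a => tendsto_pi_nhds.2 fun b => ?_
  have h := (tendsto_size_ratio H.size).mul ((H.prod a b).sub ((H.coord a).mul (H.coord b)))
  rw [mul_zero, sub_zero, one_mul] at h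
  refine h.congr' ?_
  filter_upwards [H.size.eventually_ne_atTop 0] with k hk
  rw [sampleCov_apply hk μ]

lemma sampleCov_resampled_tendsto : Tendsto (fun z : Σ k, (Fin (n k) → Fin (n k)) =>
    sampleCov fun j => x z.1 (z.2 j)) J (𝓝 S) := by
  refine tendsto_pi_nhds.2 fun a => tendsto_pi_nhds.2 fun b => ?_
  have h := ((tendsto_size_ratio H.size).comp tendsto_fst_inProbability).mul
    ((H.prod_resampled a b).sub ((H.coord_resampled a).mul (H.coord_resampled b)))
  rw [mul_zero, sub_zero, one_mul] at h
  refine h.congr' ?_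
  filter_upwards [H.eventually_size_ne_zero] with z hz
  rw [sampleCov_apply hz μ]
  rfl

/-- Writing p* q* - p q = q* (p* - p) + p (q* - q) for the coordinate means makes every term a
bounded deviation times a convergent factor. -/
lemma sampleCov_diff (a b : Fin d) : ∀ᶠ z : Σ k, (Fin (n k) → Fin (n k)) in J,
    √(n z.1 : ℝ) * (sampleCov (fun j => x z.1 (z.2 j)) a b - sampleCov (x z.1) a b) =
      ((n z.1 : ℝ) - 1)⁻¹ * n z.1 * (bootDev x (centeredProd μ a b) z -
        (mean fun j => centeredCoord μ b (x z.1 (z.2 j))) * bootDev x (centeredCoord μ a) z -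
        (mean fun i => centeredCoord μ a (x z.1 i)) * bootDev x (centeredCoord μ b) z) := by
  filter_upwards [H.eventually_size_ne_zero] with z hz
  rw [sampleCov_apply hz μ, sampleCov_apply hz μ]
  simp only [bootDev]
  ring

lemma tendsto_mul_sampleCov_diff {U : (Σ k, (Fin (n k) → Fin (n k))) → ℝ}
    (hU : Tendsto U J (𝓝 0)) (a b : Fin d) :
    Tendsto (fun z => U z * (√(n z.1 : ℝ) *
      (sampleCov (fun j => x z.1 (z.2 j)) a b - sampleCov (x z.1) a b))) J (𝓝 0) := by
  have hr := (tendsto_size_ratio H.size).comp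
    (tendsto_fst_inProbability (P := fun k => resampling (n k)))
  have hc := (H.coord a).comp (tendsto_fst_inProbability (P := fun k => resampling (n k)))
  have hUr := hU.mul hr
  have hU2 := hUr.mul (H.coord_resampled b)
  have hU3 := hUr.mul hc
  simp only [zero_mul] at hUr hU2 hU3
  have h := ((tendsto_mul_bootDev H.size (H.prodSq a b).choose_spec hUr).sub
    (tendsto_mul_bootDev H.size (H.coordSq a) hU2)).sub
    (tendsto_mul_bootDev H.size (H.coordSq b) hU3)
  simp only [sub_zero] at h
  refine h.congr' ?_
  filter_upwards [H.sampleCov_diff a b] with z hz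
  rw [hz]
  simp only [Function.comp_apply]
  ring

/-- Recentering at the sample mean is negligible: its deviations carry factors tending to 0, and n /
(n - 1) → 1. -/
lemma tendsto_sampleCov_diff_sub (a b : Fin d) :
    Tendsto (fun z => √(n z.1 : ℝ) *
      (sampleCov (fun j => x z.1 (z.2 j)) a b - sampleCov (x z.1) a b) -
      bootDev x (centeredProd μ a b) z) J (𝓝 0) := by
  have hr := (tendsto_size_ratio H.size).comp
    (tendsto_fst_inProbability (P := fun k => resampling (n k)))
  have hc := (H.coord a).comp (tendsto_fst_inProbability (P := fun k => resampling (n k)))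
  have hU1 := hr.sub_const 1
  have hU2 := hr.mul (H.coord_resampled b)
  have hU3 := hr.mul hc
  simp only [mul_zero, sub_self] at hU1 hU2 hU3
  have h := ((tendsto_mul_bootDev H.size (H.prodSq a b).choose_spec hU1).sub
    (tendsto_mul_bootDev H.size (H.coordSq a) hU2)).sub
    (tendsto_mul_bootDev H.size (H.coordSq b) hU3)
  simp only [sub_zero] at h
  refine h.congr' ?_
  filter_upwards [H.sampleCov_diff a b] with z hz
  rw [hz]
  simp only [Function.comp_apply]
  ring

lemma tendsto_trace_mul_sampleCov_diff
    {A : (Σ k, (Fin (n k) → Fin (n k))) → Matrix (Fin d) (Fin d) ℝ} (hA : Tendsto A J (𝓝 0)) :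
    Tendsto (fun z => √(n z.1 : ℝ) *
      (A z * (sampleCov (fun j => x z.1 (z.2 j)) - sampleCov (x z.1))).trace) J (𝓝 0) := by
  have h := tendsto_finsetSum (Finset.univ : Finset (Fin d)) fun a _ =>
    tendsto_finsetSum (Finset.univ : Finset (Fin d)) fun b _ =>
      H.tendsto_mul_sampleCov_diff (tendsto_pi_nhds.1 (tendsto_pi_nhds.1 hA a) b) b a
  simp only [Finset.sum_const_zero] at h
  refine h.congr fun z => ?_
  simp only [Matrix.trace, Matrix.diag, Matrix.mul_apply, Matrix.sub_apply, Finset.mul_sum]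
  refine Finset.sum_congr rfl fun a _ => Finset.sum_congr rfl fun b _ => ?_
  ring

lemma tendsto_trace_sampleCov_diff_sub (B : Matrix (Fin d) (Fin d) ℝ) :
    Tendsto (fun z => √(n z.1 : ℝ) *
      (B * (sampleCov (fun j => x z.1 (z.2 j)) - sampleCov (x z.1))).trace -
        ∑ a, ∑ b, B a b * bootDev x (centeredProd μ a b) z) J (𝓝 0) := by
  have h := tendsto_finsetSum (Finset.univ : Finset (Fin d)) fun a _ =>
    tendsto_finsetSum (Finset.univ : Finset (Fin d)) fun b _ =>
      (H.tendsto_sampleCov_diff_sub b a).const_mul (B a b)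
  simp only [Finset.sum_const_zero, mul_zero] at h
  refine h.congr fun z => ?_
  have hcomm : ∀ a b, centeredProd μ b a = centeredProd μ a b := fun a b => by
    ext y
    simp only [centeredProd, mul_comm]
  simp only [Matrix.trace, Matrix.diag, Matrix.mul_apply, Matrix.sub_apply, Finset.mul_sum,
    ← Finset.sum_sub_distrib]
  refine Finset.sum_congr rfl fun a _ => Finset.sum_congr rfl fun b _ => ?_
  rw [hcomm]
  ring

/-- The bootstrapped estimator is asymptotically equivalent to its linearization. -/
lemma tendsto_gwEstimator_diff_sub (hS : S.PosDef) {Ξ : Matrix (Fin d) (Fin d) ℝ} (hΞ : Ξ.PosDef)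
    (ν : EuclideanSpace ℝ (Fin d)) :
    Tendsto (fun z => √(n z.1 : ℝ) *
      (gwEstimator (multivariateGaussian ν Ξ) (fun j => x z.1 (z.2 j)) -
        gwEstimator (multivariateGaussian ν Ξ) (x z.1)) -
      bootDev x (influence μ ν (1 - otMatrix Ξ S)) z) J (𝓝 0) := by
  have hfst := tendsto_fst_inProbability (P := fun k => resampling (n k)) (l := atTop)
  have hpsd1 : ∀ᶠ z in J, (sampleCov fun j => x z.1 (z.2 j)).PosSemidef :=
    H.eventually_size_ne_zero.mono fun z hz => posSemidef_sampleCov hz _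
  have hpsd2 : ∀ᶠ z in J, (sampleCov (x z.1)).PosSemidef :=
    H.eventually_size_ne_zero.mono fun z hz => posSemidef_sampleCov hz _
  have hcov2 := H.sampleCov_tendsto.comp hfst
  have hA1 := (tendsto_otMatrix H.sampleCov_resampled_tendsto hpsd1 hΞ hS).sub_const (otMatrix Ξ S)
  have hA2 := (tendsto_otMatrix hcov2 hpsd2 hΞ hS).sub_const (otMatrix Ξ S)
  rw [sub_self] at hA1 hA2
  have ht1 := H.tendsto_trace_mul_sampleCov_diff hA1
  have ht2 := H.tendsto_trace_mul_sampleCov_diff hA2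
  -- This is the scaled remainder of the mean term ‖m - ν‖²: a bounded deviation times the sum of
  -- two errors of means, which tends to 0.
  have hs := tendsto_finsetSum (Finset.univ : Finset (Fin d)) fun a _ =>
    tendsto_mul_bootDev H.size (H.coordSq a)
      (by simpa using (H.coord_resampled a).add ((H.coord a).comp hfst))
  rw [Finset.sum_const_zero] at hs
  have hB := H.tendsto_trace_sampleCov_diff_sub (1 - otMatrix Ξ S)
  have hbound := (hs.abs.add (ht1.abs.add ht2.abs)).add hB.abs
  simp only [abs_zero, add_zero] at hbound
  refine squeeze_zero_norm' ?_ hbound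
  filter_upwards [H.eventually_size_ne_zero,
    eventually_posDef H.sampleCov_resampled_tendsto hpsd1 hS,
    eventually_posDef hcov2 hpsd2 hS] with z hz hp1 hp2
  have key := abs_sqWasserstein_sub_sub_le hΞ hp1 hp2 (otMatrix Ξ S) μ ν
    (sampleMean fun j => x z.1 (z.2 j)) (sampleMean (x z.1))
  have hmd : ∀ a, √(n z.1 : ℝ) * ((sampleMean fun j => x z.1 (z.2 j)) a - sampleMean (x z.1) a) =
      bootDev x (centeredCoord μ a) z := by
    intro a
    have e1 := sampleMean_sub_apply hz μ (fun j => x z.1 (z.2 j)) a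
    have e2 := sampleMean_sub_apply hz μ (x z.1) a
    simp only [bootDev]
    rw [← e1, ← e2]
    ring
  -- `bootDev` is linear in its test function.
  have hinf : bootDev x (influence μ ν (1 - otMatrix Ξ S)) z =
      ∑ a, 2 * (μ a - ν a) * bootDev x (centeredCoord μ a) z +
        ∑ a, ∑ b, (1 - otMatrix Ξ S) a b * bootDev x (centeredProd μ a b) z := by
    simp only [bootDev]
    rw [mean_influence, mean_influence, add_sub_add_comm, ← Finset.sum_sub_distrib,
      ← Finset.sum_sub_distrib, mul_add, Finset.mul_sum, Finset.mul_sum]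
    simp_rw [← Finset.sum_sub_distrib, Finset.mul_sum]
    congr 1
    · exact Finset.sum_congr rfl fun a _ => by ring
    · exact Finset.sum_congr rfl fun a _ => Finset.sum_congr rfl fun b _ => by ring
  have hq : (0 : ℝ) ≤ √(n z.1 : ℝ) := Real.sqrt_nonneg _
  have key2 := mul_le_mul_of_nonneg_left key hq
  rw [← abs_of_nonneg hq, ← abs_mul, mul_add |√(n z.1 : ℝ)|, mul_add |√(n z.1 : ℝ)|, ← abs_mul,
    ← abs_mul, ← abs_mul, mul_sub √(n z.1 : ℝ), mul_add √(n z.1 : ℝ),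
    Finset.mul_sum, Finset.mul_sum] at key2
  have hl : ∑ a, √(n z.1 : ℝ) * (2 * (μ a - ν a) *
      ((sampleMean fun j => x z.1 (z.2 j)) a - sampleMean (x z.1) a)) =
      ∑ a, 2 * (μ a - ν a) * bootDev x (centeredCoord μ a) z := by
    refine Finset.sum_congr rfl fun a _ => ?_
    rw [← hmd]
    ring
  have hr : ∑ a, √(n z.1 : ℝ) * (((sampleMean fun j => x z.1 (z.2 j)) a - sampleMean (x z.1) a) *
      (((sampleMean fun j => x z.1 (z.2 j)) a - μ a) + (sampleMean (x z.1) a - μ a))) =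
      ∑ a, ((mean fun j => centeredCoord μ a (x z.1 (z.2 j))) +
        (mean fun i => centeredCoord μ a (x z.1 i))) * bootDev x (centeredCoord μ a) z := by
    refine Finset.sum_congr rfl fun a _ => ?_
    rw [← hmd, ← sampleMean_sub_apply hz μ (fun j => x z.1 (z.2 j)) a,
      ← sampleMean_sub_apply hz μ (x z.1) a]
    ring
  rw [hl, hr] at key2
  rw [hinf, Real.norm_eq_abs]
  simp only [gwEstimator, Function.comp_apply]
  have tri : ∀ p q r s : ℝ, |p - (q + r)| ≤ |p - (q + s)| + |s - r| := fun p q r s => by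
    refine le_trans (le_of_eq ?_) (abs_add_le _ _)
    congr 1
    ring
  exact (tri _ _ _ _).trans (add_le_add_left key2 _)

/-- Consistency of the bootstrap along a sequence of samples. -/
lemma tendsto_bootstrapLaw (hS : S.PosDef) {Ξ : Matrix (Fin d) (Fin d) ℝ} (hΞ : Ξ.PosDef)
    (ν : EuclideanSpace ℝ (Fin d)) {c s m : ℝ}
    (h1 : Tendsto (fun k => mean fun i => influence μ ν (1 - otMatrix Ξ S) (x k i)) atTop (𝓝 c))
    (h2 : Tendsto (fun k => mean fun i => influence μ ν (1 - otMatrix Ξ S) (x k i) ^ 2) atTop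
      (𝓝 s))
    (h3 : Tendsto (fun k => mean fun i => |influence μ ν (1 - otMatrix Ξ S) (x k i)| ^ 3) atTop
      (𝓝 m)) (hv : 0 ≤ s - c ^ 2) :
    Tendsto (fun k => bootstrapLaw (multivariateGaussian ν Ξ) (x k)) atTop
      (𝓝 (centeredNormal (s - c ^ 2))) := by
  rw [ProbabilityMeasure.tendsto_iff_tendsto_charFun]
  intro t
  -- By Lévy's continuity theorem characteristic functions suffice, and by Slutsky the estimator may
  -- be replaced by its linearization.
  have h := tendsto_integral_exp_of_tendsto_sub (P := fun k => resampling (n k))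
    (fun _ => Measurable.of_discrete) (fun _ => Measurable.of_discrete)
    (H.tendsto_gwEstimator_diff_sub hS hΞ ν) t
    (tendsto_integral_resampling_exp H.size
      (fun k i => influence μ ν (1 - otMatrix Ξ S) (x k i)) h1 h2 h3 t)
  convert h using 2
  · simp only [bootstrapLaw, ProbabilityMeasure.coe_mk]
    rw [charFun_apply_real, integral_map (Measurable.of_discrete).aemeasurable
      (by fun_prop)]
    simp
  · simp only [centeredNormal, ProbabilityMeasure.coe_mk]
    rw [charFun_gaussianReal, Real.coe_toNNReal _ hv]
    push_cast
    congr 1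
    ring

end MomentsConverge

end BootstrapLimit

/-! ### Samples from a Gaussian law -/

section Integrability

variable {d : ℕ}

/-- Having all finite moments is stable under products, by Hölder with exponents 2p and 2p. -/
lemma memLp_mul_of_forall {α : Type*} [MeasurableSpace α] {P : Measure α} {f g : α → ℝ}
    (hf : ∀ p : ℝ≥0∞, p ≠ ∞ → MemLp f p P) (hg : ∀ p : ℝ≥0∞, p ≠ ∞ → MemLp g p P) (p : ℝ≥0∞)
    (hp : p ≠ ∞) : MemLp (fun x => f x * g x) p P := by
  have h2 : 2 * p ≠ ∞ := ENNReal.mul_ne_top ENNReal.ofNat_ne_top hp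
  have : ENNReal.HolderTriple (2 * p) (2 * p) p := ⟨by
    rw [ENNReal.mul_inv (Or.inl two_ne_zero) (Or.inl ENNReal.ofNat_ne_top), ← two_mul,
      ← mul_assoc, ENNReal.mul_inv_cancel two_ne_zero ENNReal.ofNat_ne_top, one_mul]⟩
  exact (hg _ h2).mul (hf _ h2)

variable (P : Measure (EuclideanSpace ℝ (Fin d))) [IsGaussian P] (μ ν : EuclideanSpace ℝ (Fin d))

lemma memLp_centeredCoord (a : Fin d) (p : ℝ≥0∞) (hp : p ≠ ∞) :
    MemLp (centeredCoord μ a) p P :=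
  memLp_coord_sub P (μ a) a hp

lemma memLp_centeredProd (a b : Fin d) (p : ℝ≥0∞) (hp : p ≠ ∞) :
    MemLp (centeredProd μ a b) p P :=
  memLp_mul_of_forall (memLp_centeredCoord P μ a) (memLp_centeredCoord P μ b) p hp

lemma memLp_influence (B : Matrix (Fin d) (Fin d) ℝ) (p : ℝ≥0∞) (hp : p ≠ ∞) :
    MemLp (influence μ ν B) p P := by
  have h : influence μ ν B = fun x => ∑ a, 2 * (μ a - ν a) * centeredCoord μ a x +
      ∑ a, ∑ b, B a b * centeredProd μ a b x := funext (influence_eq_sum μ ν B)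
  rw [h]
  exact (memLp_finsetSum _ fun a _ => (memLp_centeredCoord P μ a p hp).const_mul _).add
    (memLp_finsetSum _ fun a _ => memLp_finsetSum _ fun b _ =>
      (memLp_centeredProd P μ a b p hp).const_mul (B a b))

lemma measurable_centeredCoord (a : Fin d) : Measurable (centeredCoord μ a) := by
  unfold centeredCoord
  fun_prop

lemma measurable_centeredProd (a b : Fin d) : Measurable (centeredProd μ a b) :=
  (measurable_centeredCoord μ a).mul (measurable_centeredCoord μ b)

lemma measurable_influence (B : Matrix (Fin d) (Fin d) ℝ) : Measurable (influence μ ν B) := by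
  have h : influence μ ν B = fun x => ∑ a, 2 * (μ a - ν a) * centeredCoord μ a x +
      ∑ a, ∑ b, B a b * centeredProd μ a b x := funext (influence_eq_sum μ ν B)
  rw [h]
  exact (Finset.measurable_fun_sum _ fun a _ => (measurable_centeredCoord μ a).const_mul _).add
    (Finset.measurable_fun_sum _ fun a _ => Finset.measurable_fun_sum _ fun b _ =>
      (measurable_centeredProd μ a b).const_mul (B a b))

end Integrability

/-! ### The law of large numbers as convergence along a filter on samples -/

section LawOfLargeNumbers

variable {E : Type*} [MeasurableSpace E]

/-- The filter on samples for which the sample size tends to infinity, and the sample mean of each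
function in `s` tends to its integral under `P`. -/
def momentFilter (P : Measure E) (s : Set (E → ℝ)) : Filter (Σ n : ℕ, (Fin n → E)) :=
  comap Sigma.fst atTop ⊓
    ⨅ h : s, comap (fun p => mean fun i => h.1 (p.2 i)) (𝓝 (∫ y, h.1 y ∂P))

/-- Countable generation allows limits along the filter to be tested on sequences of samples. -/
lemma isCountablyGenerated_momentFilter (P : Measure E) {s : Set (E → ℝ)} (hs : s.Countable) :
    (momentFilter P s).IsCountablyGenerated := by
  have := hs.to_subtype
  unfold momentFilter
  infer_instance

lemma tendsto_fst_momentFilter (P : Measure E) (s : Set (E → ℝ)) :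
    Tendsto Sigma.fst (momentFilter P s) atTop :=
  tendsto_comap.mono_left inf_le_left

lemma tendsto_mean_momentFilter (P : Measure E) {s : Set (E → ℝ)} {h : E → ℝ} (hh : h ∈ s) :
    Tendsto (fun p : Σ n : ℕ, (Fin n → E) => mean fun i => h (p.2 i)) (momentFilter P s)
      (𝓝 (∫ y, h y ∂P)) :=
  tendsto_comap.mono_left (inf_le_right.trans (iInf_le _ (⟨h, hh⟩ : s)))

variable {Ω : Type*} [MeasurableSpace Ω] {Pr : Measure Ω} [IsProbabilityMeasure Pr]
  {X : ℕ → Ω → E} {P : Measure E}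

/-- The law of large numbers. -/
lemma tendsto_mean_inProbability (hX : ∀ i, HasLaw (X i) P Pr) (hindep : iIndepFun X Pr)
    {h : E → ℝ} (hm : Measurable h) (hi : Integrable h P) :
    Tendsto (fun q : Σ _ : ℕ, Ω => mean fun i : Fin q.1 => h (X i q.2))
      (inProbability (fun _ => Pr) atTop) (𝓝 (∫ y, h y ∂P)) := by
  have hae : ∀ i, AEMeasurable (fun ω => h (X i ω)) Pr := fun i =>
    hm.comp_aemeasurable (hX i).aemeasurable
  have hint : ∫ ω, h (X 0 ω) ∂Pr = ∫ y, h y ∂P := by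
    rw [← (hX 0).map_eq, integral_map (hX 0).aemeasurable hm.aestronglyMeasurable]
  have hlln := strong_law_ae_real (μ := Pr) (fun i ω => h (X i ω))
    (by
      have h1 := hi
      rw [← (hX 0).map_eq] at h1
      exact h1.comp_aemeasurable (hX 0).aemeasurable)
    (fun i j hij => (hindep.indepFun hij).comp hm hm)
    (fun i => (IdentDistrib.mk (hX i).aemeasurable (hX 0).aemeasurable
      ((hX i).map_eq.trans (hX 0).map_eq.symm)).comp hm)
  rw [hint] at hlln
  have hmeas := tendstoInMeasure_of_tendsto_ae (μ := Pr)
    (f := fun n ω => (∑ i ∈ Finset.range n, h (X i ω)) / n) (g := fun _ => ∫ y, h y ∂P)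
    (fun n => ((Finset.aemeasurable_fun_sum _ fun i _ => hae i).div_const _).aestronglyMeasurable)
    hlln
  rw [tendsto_inProbability_iff]
  intro ε hε
  refine (tendstoInMeasure_iff_norm.1 hmeas ε hε).congr fun n => ?_
  congr 1
  ext ω
  simp only [Set.mem_ofPred_eq, mean, Real.norm_eq_abs]
  rw [Fin.sum_univ_eq_sum_range (fun i => h (X i ω)), div_eq_inv_mul]

/-- Composition with this map turns any deterministic limit along `momentFilter` into a limit in
probability for the random samples. -/
lemma tendsto_sample_momentFilter (hX : ∀ i, HasLaw (X i) P Pr) (hindep : iIndepFun X Pr)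
    {s : Set (E → ℝ)} (hs : ∀ h ∈ s, Measurable h ∧ Integrable h P) :
    Tendsto (fun q : Σ _ : ℕ, Ω => (⟨q.1, fun i => X i q.2⟩ : Σ n : ℕ, (Fin n → E)))
      (inProbability (fun _ => Pr) atTop) (momentFilter P s) := by
  refine tendsto_inf.2 ⟨tendsto_comap_iff.2 tendsto_fst_inProbability,
    tendsto_iInf.2 fun h => tendsto_comap_iff.2 ?_⟩
  exact tendsto_mean_inProbability hX hindep (hs h.1 h.2).1 (hs h.1 h.2).2

end LawOfLargeNumbers

/-! ### Consistency of the bootstrap in probability -/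

section Consistency

variable {d : ℕ}

/-- The functions whose sample means determine the limit of the bootstrap law. -/
def testFunctions (μ ν : EuclideanSpace ℝ (Fin d)) (B : Matrix (Fin d) (Fin d) ℝ) :
    Set (EuclideanSpace ℝ (Fin d) → ℝ) :=
  Set.range (centeredCoord μ) ∪ Set.range (fun p : Fin d × Fin d => centeredProd μ p.1 p.2) ∪
    Set.range (fun (p : Fin d × Fin d) x => centeredProd μ p.1 p.2 x ^ 2) ∪
    {influence μ ν B, fun x => influence μ ν B x ^ 2, fun x => |influence μ ν B x| ^ 3}

lemma countable_testFunctions (μ ν : EuclideanSpace ℝ (Fin d)) (B : Matrix (Fin d) (Fin d) ℝ) :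
    (testFunctions μ ν B).Countable :=
  (((Set.countable_range _).union (Set.countable_range _)).union (Set.countable_range _)).union
    (Set.toFinite _).countable

lemma measurable_and_integrable_of_mem_testFunctions (P : Measure (EuclideanSpace ℝ (Fin d)))
    [IsGaussian P] (μ ν : EuclideanSpace ℝ (Fin d)) (B : Matrix (Fin d) (Fin d) ℝ) :
    ∀ h ∈ testFunctions μ ν B, Measurable h ∧ Integrable h P := by
  have hg := measurable_influence μ ν B
  rintro h (((⟨a, rfl⟩ | ⟨p, rfl⟩) | ⟨p, rfl⟩) | rfl | rfl | rfl)
  · exact ⟨measurable_centeredCoord μ a,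
      memLp_one_iff_integrable.1 (memLp_centeredCoord P μ a 1 ENNReal.one_ne_top)⟩
  · exact ⟨measurable_centeredProd μ p.1 p.2,
      memLp_one_iff_integrable.1 (memLp_centeredProd P μ p.1 p.2 1 ENNReal.one_ne_top)⟩
  · exact ⟨(measurable_centeredProd μ p.1 p.2).pow_const 2,
      (memLp_centeredProd P μ p.1 p.2 2 ENNReal.ofNat_ne_top).integrable_sq⟩
  · exact ⟨hg, memLp_one_iff_integrable.1 (memLp_influence P μ ν B 1 ENNReal.one_ne_top)⟩
  · exact ⟨hg.pow_const 2, (memLp_influence P μ ν B 2 ENNReal.ofNat_ne_top).integrable_sq⟩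
  · exact ⟨hg.abs.pow_const 3,
      (memLp_influence P μ ν B (3 : ℕ) (ENNReal.natCast_ne_top 3)).integrable_norm_pow three_ne_zero⟩

lemma variance_influence {S Ξ : Matrix (Fin d) (Fin d) ℝ} (hS : S.PosDef) (hΞ : Ξ.PosDef)
    (μ ν : EuclideanSpace ℝ (Fin d)) (κ : Fin d → ℝ)
    (r : OrthonormalBasis (Fin d) ℝ (EuclideanSpace ℝ (Fin d)))
    (hκr : IsEigendecomposition (CFC.sqrt Ξ * S * CFC.sqrt Ξ) κ r) :
    Var[influence μ ν (1 - otMatrix Ξ S); multivariateGaussian μ S] =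
      asymptoticVariance μ ν S Ξ κ r := by
  rw [asymptoticVariance_eq hS hΞ μ ν κ r hκr]
  exact variance_quadratic_multivariateGaussian hS.posSemidef
    (Matrix.isHermitian_one.sub (posDef_otMatrix hΞ hS).isHermitian) μ (μ - ν)

lemma tendsto_bootstrapLaw_momentFilter {S Ξ : Matrix (Fin d) (Fin d) ℝ} (hS : S.PosDef)
    (hΞ : Ξ.PosDef) (μ ν : EuclideanSpace ℝ (Fin d)) (κ : Fin d → ℝ)
    (r : OrthonormalBasis (Fin d) ℝ (EuclideanSpace ℝ (Fin d)))
    (hκr : IsEigendecomposition (CFC.sqrt Ξ * S * CFC.sqrt Ξ) κ r) :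
    Tendsto (fun p : Σ n : ℕ, (Fin n → EuclideanSpace ℝ (Fin d)) =>
        bootstrapLaw (multivariateGaussian ν Ξ) p.2)
      (momentFilter (multivariateGaussian μ S) (testFunctions μ ν (1 - otMatrix Ξ S)))
      (𝓝 (centeredNormal (asymptoticVariance μ ν S Ξ κ r))) := by
  set s := testFunctions μ ν (1 - otMatrix Ξ S)
  set P := multivariateGaussian μ S
  set g := influence μ ν (1 - otMatrix Ξ S)
  have := isCountablyGenerated_momentFilter P (countable_testFunctions μ ν (1 - otMatrix Ξ S))
  -- The sizes of the samples p k need not be k, which is why the preceding limit theorems allow an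
  -- arbitrary n k → ∞.
  refine tendsto_of_seq_tendsto fun p hp => ?_
  have hmean : ∀ h ∈ s, Tendsto (fun k => mean fun i => h ((p k).2 i)) atTop
      (𝓝 (∫ y, h y ∂P)) := fun h hh => (tendsto_mean_momentFilter P hh).comp hp
  have H : MomentsConverge μ S (fun k => (p k).1) (fun k => (p k).2) := by
    refine ⟨(tendsto_fst_momentFilter P s).comp hp, fun a => ?_, fun a b => ?_, fun a b => ?_⟩
    · have h1 := hmean (centeredCoord μ a) (Or.inl (Or.inl (Or.inl ⟨a, rfl⟩)))
      rwa [show ∫ y, centeredCoord μ a y ∂P = 0 from integral_coord_sub μ S a] at h1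
    · have h1 := hmean (centeredProd μ a b) (Or.inl (Or.inl (Or.inr ⟨(a, b), rfl⟩)))
      rwa [show ∫ y, centeredProd μ a b y ∂P = S a b from
        integral_coord_sub_mul μ hS.posSemidef a b] at h1
    · exact ⟨_, hmean (fun x => centeredProd μ a b x ^ 2) (Or.inl (Or.inr ⟨(a, b), rfl⟩))⟩
  have hvar : Var[g; P] = ∫ y, g y ^ 2 ∂P - (∫ y, g y ∂P) ^ 2 := by
    rw [variance_eq_sub (memLp_influence P μ ν _ 2 ENNReal.ofNat_ne_top)]
    rfl
  have hv : Var[g; P] = asymptoticVariance μ ν S Ξ κ r := variance_influence hS hΞ μ ν κ r hκr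
  rw [← hv, hvar]
  refine H.tendsto_bootstrapLaw hS hΞ ν (hmean g (Or.inr (Or.inl rfl)))
    (hmean (fun x => g x ^ 2) (Or.inr (Or.inr (Or.inl rfl))))
    (hmean (fun x => |g x| ^ 3) (Or.inr (Or.inr (Or.inr rfl)))) ?_
  rw [← hvar]
  exact variance_nonneg _ _

end Consistency

end GaussianWasserstein

end

theorem mainTheorem8 {d : ℕ}
    (μ ν : EuclideanSpace ℝ (Fin d)) (S Ξ : Matrix (Fin d) (Fin d) ℝ)
    (hS : S.PosDef) (hΞ : Ξ.PosDef)
    (hPQ : multivariateGaussian μ S ≠ multivariateGaussian ν Ξ)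
    (κ : Fin d → ℝ) (r : OrthonormalBasis (Fin d) ℝ (EuclideanSpace ℝ (Fin d)))
    (hκr : GaussianWasserstein.IsEigendecomposition (CFC.sqrt Ξ * S * CFC.sqrt Ξ) κ r)
    {Ω : Type*} [MeasurableSpace Ω] (Pr : Measure Ω) [IsProbabilityMeasure Pr]
    (X : ℕ → Ω → EuclideanSpace ℝ (Fin d))
    (hX : ∀ i, HasLaw (X i) (multivariateGaussian μ S) Pr)
    (hindep : iIndepFun X Pr)
    (ρ : MetricSpace (ProbabilityMeasure ℝ))
    (hρ : ρ.toUniformSpace.toTopologicalSpace = ProbabilityMeasure.instTopologicalSpace) :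
    TendstoInMeasure Pr
      (fun (n : ℕ) (ω : Ω) =>
        ρ.dist
          (GaussianWasserstein.bootstrapLaw (multivariateGaussian ν Ξ)
            (fun i : Fin n => X i ω))
          (GaussianWasserstein.centeredNormal
            (GaussianWasserstein.asymptoticVariance μ ν S Ξ κ r)))
      atTop (fun _ => 0) := by
  have h1 := (GaussianWasserstein.tendsto_bootstrapLaw_momentFilter hS hΞ μ ν κ r hκr).comp
    (GaussianWasserstein.tendsto_sample_momentFilter hX hindep
      (GaussianWasserstein.measurable_and_integrable_of_mem_testFunctions _ μ ν _))
  -- The limit so far concerns only the weak topology, so it can be read in any metric inducing it.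
  -- The filter uses outer measure, hence measurability of the distance in ω is not required.
  rw [← hρ] at h1
  have h2 := (@tendsto_iff_dist_tendsto_zero _ _ ρ.toPseudoMetricSpace _ _ _).1 h1
  rw [GaussianWasserstein.tendsto_inProbability_iff] at h2
  exact tendstoInMeasure_iff_norm.2 h2
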